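/- **Theorem (Transformer can implement $\Phi^\star$-Ridge for dynamical systems).** *Transformers.* A transformer with $M$ heads and hidden dimension $n$ maps token sequences $H=[h_1,\dots,h_N]$, $h_i\in\mathbb R^{n}$ (any length $N$), to token sequences of the same length. Each layer consists of a masked attention layer $$\mathrm{Attn}(H)_i = h_i+\sum_{m=1}^M\frac1i\sum_{j=1}^i \sigma\big(\langle Q_mh_i,K_mh_j\rangle\big)V_mh_j$$ followed by an MLP layer $h_i\mapsto h_i+W_2\,\sigma(W_1h_i)$, where $\sigma(t)=\max\{t,0\}$ is applied entrywise and $Q_m,K_m,V_m,W_1,W_2\in\mathbb R^{n\times n}$. Write $\mathrm{Attn}^{(1)}$ for the attention layer of the first layer, $\mathrm{TF}^{(1)}$ for the first layer and $\mathrm{TF}^{(1:\ell)}$ for the composition of the first $\ell$ layers. *Data.* Let $k,d,D,L\ge 1$. For a dataset $x_1,\dots,x_N\in\mathbb R^d$ put $x_j:=0$ for $j\le 0$ and $\bar x_i:=[x_{i-k+1};\dots;x_i]\in\mathbb R^{kd}$. (The case of interest is the dynamical system $x_{i+1}=W^\top\Phi^\star(\bar x_i)+\text{noise}$, but the dataset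 may be arbitrary.) Let $\Phi^\star(v)=\sigma_\rho(B_L\sigma_\rho(B_{L-1}\cdots\sigma_\rho(B_1v)\cdots))$ with $B_1\in\mathbb R^{D\times kd}$, $B_2,\dots,B_L\in\mathbb R^{D\times D}$, $\sigma_\rho(t)=\max\{t,\rho t\}$ entrywise and $\rho\in(0,1)$. For $\lambda>0$ and $i\in[N]$ let $$\hat W_i=\operatorname*{argmin}_{W\in\mathbb R^{D\times d}}\ \frac1{2(i-1)}\sum_{j=1}^{i-1}\big\|W^\top\Phi^\star(\bar x_j)-x_{j+1}\big\|_2^2+\frac\lambda2\|W\|_F^2,\qquad \hat W_1=0 .$$ *Claim.* There is an absolute constant $C>0$ such that for all $k,d,D,L\ge1$, all $\Phi^\star$ as above, all $\lambda,B_\Phi,B_w,B_y>0$ and all $0<\varepsilon<B_\Phi B_w/2$, with $\kappa:=1+B_\Phi^2/\lambda$, there exists a transformer $\mathrm{TF}$ (not depending on $N$ or on the dataset) with at least $L+2$ and at most $L+2+C\,\kappa\log(B_\Phi B_w/\varepsilon)$ layers, $\max\{3d,5,k\}$ heads, and hidden dimension $D_{\rm hid}=\max\{2(k+1),D\}d+3(D+d)+5$,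 such that the following holds. For every $N$ and every dataset with $\|\Phi^\star(\bar x_i)\|_2\le B_\Phi$, $\|x_i\|_\infty\le B_y$ and $\max_{c\in[d]}\|(\hat W_i)_{:,c}\|_2\le B_w/2$ for all $i\in[N]$, and for the input $H$ with tokens $h_i=[x_i;0;1;i;i^2;i^3]\in\mathbb R^{D_{\rm hid}}$ (where, here and below, $0$ before $1;i;i^2;i^3$ stands for the zero padding that makes the vector have length $D_{\rm hid}$), for all $i\in[N]$: (a) $\mathrm{Attn}^{(1)}(H)_i=[\bar x_i;0;1;i;i^2;i^3]$ and $\mathrm{TF}^{(1)}(H)_i=[\sigma_\rho(B_1\bar x_i);x_i;0;1;i;i^2;i^3]$; (b) $\mathrm{TF}^{(1:L+1)}(H)_i=[\Phi^\star(\bar x_i);0_d;\phi_i;x_i;0;1;i;i^2;i^3]$, where $\phi_1=0_D$ and $\phi_i=\Phi^\star(\bar x_{i-1})$ for $i\ge2$; (c) the prediction $\hat x_{i+1}:=[\mathrm{TF}(H)_i]_{1:d}$ satisfies $\|\hat x_{i+1}-\hat W_i^\top\Phi^\star(\bar x_i)\|_\infty\le\varepsilon$. -/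

import Mathlib

open scoped Matrix

/-! ### Decoder transformers with normalized ReLU attention

An input with `N` tokens in `ℝⁿ` is a map `H : Fin N → Fin n → ℝ`; `H i` is the token (column) at
position `i + 1`. -/

/-- One attention head: query, key and value matrices. -/
structure AttnHead (n : ℕ) where
  Q : Matrix (Fin n) (Fin n) ℝ
  K : Matrix (Fin n) (Fin n) ℝ
  V : Matrix (Fin n) (Fin n) ℝ

/-- One transformer layer with `M` heads: a masked attention layer followed by an MLP layer. -/
structure TFLayer (n M : ℕ) where
  heads : Fin M → AttnHead n
  W₁ : Matrix (Fin n) (Fin n) ℝ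
  W₂ : Matrix (Fin n) (Fin n) ℝ

/-- The ReLU activation. -/
noncomputable def relu (t : ℝ) : ℝ := max t 0

/-- Masked attention with ReLU activation normalized by the (one-based) query position `i`:
`h̃ᵢ = hᵢ + ∑ₘ (1/i) ∑_{j ≤ i} relu ⟨Qₘ hᵢ, Kₘ hⱼ⟩ • Vₘ hⱼ`. -/
noncomputable def attn {n M N : ℕ} (θ : Fin M → AttnHead n) (H : Fin N → Fin n → ℝ) :
    Fin N → Fin n → ℝ := fun i =>
  H i + ∑ m, (1 / ((i : ℕ) + 1 : ℝ)) •
    ∑ j ∈ Finset.Iic i, relu (((θ m).Q *ᵥ H i) ⬝ᵥ ((θ m).K *ᵥ H j)) • ((θ m).V *ᵥ H j)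

/-- The token-wise residual MLP layer `h ↦ h + W₂ relu(W₁ h)`. -/
noncomputable def mlpLayer {n N : ℕ} (W₁ W₂ : Matrix (Fin n) (Fin n) ℝ) (H : Fin N → Fin n → ℝ) :
    Fin N → Fin n → ℝ := fun i =>
  H i + W₂ *ᵥ (fun r => relu ((W₁ *ᵥ H i) r))

/-- The output of one transformer layer. -/
noncomputable def TFLayer.apply {n M N : ℕ} (θ : TFLayer n M) (H : Fin N → Fin n → ℝ) :
    Fin N → Fin n → ℝ :=
  mlpLayer θ.W₁ θ.W₂ (attn θ.heads H)

/-- The output of a transformer, given as the list of its layers, the first layer first. -/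
noncomputable def tfApply {n M N : ℕ} (θs : List (TFLayer n M)) (H : Fin N → Fin n → ℝ) :
    Fin N → Fin n → ℝ :=
  θs.foldl (fun G θ => θ.apply G) H

/-! ### The representation function -/

/-- The leaky ReLU with slope `ρ`, applied entrywise. -/
noncomputable def leakyReLU {m : ℕ} (ρ : ℝ) (v : Fin m → ℝ) : Fin m → ℝ :=
  fun r => max (v r) (ρ * v r)

/-- The `L`-layer MLP `v ↦ σ_ρ(B_L σ_ρ(B_{L-1} ⋯ σ_ρ(B₁ v) ⋯))`; the family `B` lists
`B₂, …, B_L` in this order. -/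
noncomputable def mlpRep {m D L : ℕ} (ρ : ℝ) (B₁ : Matrix (Fin D) (Fin m) ℝ)
    (B : Fin (L - 1) → Matrix (Fin D) (Fin D) ℝ) (v : Fin m → ℝ) : Fin D → ℝ :=
  (List.ofFn B).foldl (fun u A => leakyReLU ρ (A *ᵥ u)) (leakyReLU ρ (B₁ *ᵥ v))

/-! ### The dynamical system data

The dataset is `x : Fin N → Fin d → ℝ`. Positions are one-based natural numbers below. -/

/-- The data vector at position `j`, which is `0` when `j` is not in `{1, …, N}`. -/
def dataAt {N d : ℕ} (x : Fin N → Fin d → ℝ) (j : ℕ) : Fin d → ℝ :=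
  if h : 1 ≤ j ∧ j ≤ N then x ⟨j - 1, by omega⟩ else 0

/-- The augmented input `x̄ᵢ = [x_{i-k+1}; …; x_i] ∈ ℝ^{kd}`. Its block number `b ∈ {0, …, k-1}` is
`x_{i-k+1+b}`; the truncated subtraction sends nonpositive positions to `0`, where the data is
`0`. -/
def augInput {N d : ℕ} (k : ℕ) (x : Fin N → Fin d → ℝ) (i : ℕ) : Fin (k * d) → ℝ :=
  fun r => dataAt x (i + 1 + ((finProdFinEquiv.symm r).1 : ℕ) - k) (finProdFinEquiv.symm r).2

/-- The objective of ridge regression at position `i`,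
`(1/(2(i-1))) ∑_{j=1}^{i-1} ‖Wᵀ Φ(x̄ⱼ) - x_{j+1}‖₂² + (lam/2) ‖W‖_F²`.
For `i = 1` the data term is an empty sum, so that the only minimizer is `W = 0` if `0 < lam`. -/
noncomputable def ridgeLoss {N d D : ℕ} (k : ℕ) (Φ : (Fin (k * d) → ℝ) → Fin D → ℝ) (lam : ℝ)
    (x : Fin N → Fin d → ℝ) (i : ℕ) (W : Matrix (Fin D) (Fin d) ℝ) : ℝ :=
  1 / (2 * ((i : ℝ) - 1)) * ∑ j ∈ Finset.Icc 1 (i - 1),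
      ‖WithLp.toLp 2 (Wᵀ *ᵥ Φ (augInput k x j) - dataAt x (j + 1))‖ ^ 2
    + lam / 2 * ∑ r, ∑ c, W r c ^ 2

/-- `W` is the ridge estimator at position `i`: it minimizes `ridgeLoss`. -/
def IsPhiRidge {N d D : ℕ} (k : ℕ) (Φ : (Fin (k * d) → ℝ) → Fin D → ℝ) (lam : ℝ)
    (x : Fin N → Fin d → ℝ) (i : ℕ) (W : Matrix (Fin D) (Fin d) ℝ) : Prop :=
  ∀ W' : Matrix (Fin D) (Fin d) ℝ, ridgeLoss k Φ lam x i W ≤ ridgeLoss k Φ lam x i W'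

/-! ### Token format and size -/

/-- The vector `[u; 0; 1; i; i²; i³] ∈ ℝⁿ`, with as many zeros as fit (used for `m + 4 ≤ n`). -/
noncomputable def mkToken (n : ℕ) (i : ℕ) {m : ℕ} (u : Fin m → ℝ) : Fin n → ℝ := fun r =>
  if h : (r : ℕ) < m then u ⟨r, h⟩
  else if n ≤ (r : ℕ) + 4 then (i : ℝ) ^ ((r : ℕ) + 4 - n)
  else 0

/-- The hidden dimension `max{2(k+1), D} d + 3(D + d) + 5`. -/
def hidDim (k d D : ℕ) : ℕ := max (2 * (k + 1)) D * d + 3 * (D + d) + 5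

theorem le_hidDim (k d D : ℕ) : d ≤ hidDim k d D := by
  unfold hidDim; omega

/-- The ridge estimator exists at every position. -/
theorem exists_isPhiRidge {N d D : ℕ} (k : ℕ) (Φ : (Fin (k * d) → ℝ) → Fin D → ℝ) {lam : ℝ}
    (hlam : 0 < lam) (x : Fin N → Fin d → ℝ) (i : ℕ) (hi : 1 ≤ i) :
    ∃ W, IsPhiRidge k Φ lam x i W := by
  have hi' : (0 : ℝ) ≤ (i : ℝ) - 1 := by
    have : (1 : ℝ) ≤ i := by exact_mod_cast hi
    linarith
  set f : (Fin D → Fin d → ℝ) → ℝ := fun W => ridgeLoss k Φ lam x i (Matrix.of W) with hf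
  have hcont : Continuous f := by
    simp only [hf, ridgeLoss, Matrix.of_apply]
    refine Continuous.add (continuous_const.mul (continuous_finsetSum _ fun j _ => ?_))
      (by fun_prop)
    refine (Continuous.norm ((PiLp.continuous_toLp 2 _).comp ?_)).pow 2
    refine Continuous.sub (continuous_pi fun c => ?_) continuous_const
    simp only [Matrix.mulVec, dotProduct, Matrix.transpose_apply, Matrix.of_apply]
    fun_prop
  have hlow : ∀ W, ∀ r c, lam / 2 * W r c ^ 2 ≤ f W := by
    intro W r c
    have h1 : W r c ^ 2 ≤ ∑ r, ∑ c, W r c ^ 2 :=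
      (Finset.single_le_sum (f := fun c => W r c ^ 2) (fun _ _ => sq_nonneg _)
        (Finset.mem_univ c)).trans
      (Finset.single_le_sum (f := fun r => ∑ c, W r c ^ 2)
        (fun _ _ => Finset.sum_nonneg fun _ _ => sq_nonneg _) (Finset.mem_univ r))
    have h2 : lam / 2 * W r c ^ 2 ≤ lam / 2 * ∑ r, ∑ c, W r c ^ 2 := by gcongr
    refine h2.trans (le_add_of_nonneg_left ?_)
    positivity
  have h0 : 0 ≤ f 0 := by
    simp only [hf, ridgeLoss]
    positivity
  set R : ℝ := 2 * f 0 / lam + 1 with hR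
  have hR1 : 1 ≤ R := by rw [hR]; have : 0 ≤ 2 * f 0 / lam := by positivity
                         linarith
  have hmem : (0 : Fin D → Fin d → ℝ) ∈ Set.Icc (fun _ _ => -R) (fun _ _ => R) :=
    ⟨fun _ _ => by simp; linarith, fun _ _ => by simp; linarith⟩
  obtain ⟨W, hW, hmin⟩ := (isCompact_Icc (a := fun (_ : Fin D) (_ : Fin d) => -R)
    (b := fun _ _ => R)).exists_isMinOn ⟨0, hmem⟩ hcont.continuousOn
  refine ⟨Matrix.of W, fun W' => ?_⟩
  change f W ≤ f W'
  by_cases hW' : W' ∈ Set.Icc (fun (_ : Fin D) (_ : Fin d) => -R) (fun _ _ => R)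
  · exact hmin hW'
  · have : ∃ r c, R < |W' r c| := by
      by_contra! hcon
      exact hW' ⟨fun r c => (abs_le.mp (hcon r c)).1, fun r c => (abs_le.mp (hcon r c)).2⟩
    obtain ⟨r, c, hrc⟩ := this
    refine (hmin hmem).trans (le_trans ?_ (hlow W' r c))
    have h3 : R ≤ W' r c ^ 2 := by
      rw [← sq_abs]; nlinarith
    have h4 : lam / 2 * R ≤ lam / 2 * W' r c ^ 2 := by gcongr
    have h5 : lam / 2 * R = f 0 + lam / 2 := by rw [hR]; field_simp
    linarith

/-!
The transformer computes the representation exactly and then runs gradient descent on the ridge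
objective of every position in parallel, one layer per step. The only approximation is the finite
number of steps.

*Heads and MLPs as linear algebra.* A head can have any bilinear form in the two tokens as its
score and any linear map as its value (`exists_heads`), and an MLP layer adds a leaky ReLU layer
together with a linear map of small rank (`exists_mlp_leakyReLU`). Since tokens carry `1, i, i²,
i³`, the score `i (1 - (i - s - j)²)` is bilinear; it is positive only at `j = i - s`, where its
value `i` cancels the normalization `1 / i`. So a head can copy from `s` positions earlier
(`sum_relu_selForm`). This yields the augmented input (`exists_heads_augInput`) and, after the
layers of `Φ`, the token that holds the regression sample `(Φ(x̄ᵢ₋₁), xᵢ)` (`exists_shift_layer`).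
The first position holds the features `0`, so that its sample does not influence the regression.

*Gradient descent.* The weights `w` are stored in the query token, so the residual `(wᵀ φⱼ)_c -
x_{j,c}` is a bilinear score, and its positive and negative parts together move `w` along the
gradient (`exists_gradient_layer`). The attention averages over `i` instead of `i - 1` terms, which
corresponds to the objective times `(i - 1) / i`; the regularization gets the same factor from a
head that sees only its own token. With the step size `1 / (BΦ² + lam)` the error is multiplied by
at most `1 - 1 / (2 κ)` in each step (`norm_colVec_iterate_sub_le`): by the normal equations the
new error is the mean over the samples of vectors each of which is shorter by the required factor
(`norm_gradient_step_le`). Hence `2 κ log (BΦ Bw / ε)` steps suffice (`one_sub_pow_le_inv`).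

*Readout.* All iterates stay within `Bw`, so the score `(wᵀ Φ(x̄ⱼ))_c - BΦ Bw (i - j)²` is active
only at `j = i`, where it gives the prediction exactly (`exists_readout_layer`).
-/

/-! ### Blocks of a token -/

/-- The block of length `m` starting at entry `off` of a vector in `ℝⁿ`; entries beyond `n` read
as `0`. -/
def readBlock (n off m : ℕ) : (Fin n → ℝ) →ₗ[ℝ] (Fin m → ℝ) where
  toFun v r := if h : off + (r : ℕ) < n then v ⟨off + r, h⟩ else 0
  map_add' u v := by ext r; by_cases h : off + (r : ℕ) < n <;> simp [h]
  map_smul' a v := by ext r; by_cases h : off + (r : ℕ) < n <;> simp [h]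

/-- The vector in `ℝⁿ` that carries `u ∈ ℝᵐ` from entry `off` on and vanishes elsewhere; what
does not fit is dropped. -/
def writeBlock (n off m : ℕ) : (Fin m → ℝ) →ₗ[ℝ] (Fin n → ℝ) where
  toFun u r := if h : off ≤ (r : ℕ) ∧ (r : ℕ) < off + m then u ⟨r - off, by omega⟩ else 0
  map_add' u v := by ext r; by_cases h : off ≤ (r : ℕ) ∧ (r : ℕ) < off + m <;> simp [h]
  map_smul' a v := by ext r; by_cases h : off ≤ (r : ℕ) ∧ (r : ℕ) < off + m <;> simp [h]

theorem readBlock_apply {n off m : ℕ} (v : Fin n → ℝ) (r : Fin m) :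
    readBlock n off m v r = if h : off + (r : ℕ) < n then v ⟨off + r, h⟩ else 0 := rfl

theorem writeBlock_apply {n off m : ℕ} (u : Fin m → ℝ) (r : Fin n) :
    writeBlock n off m u r =
      if h : off ≤ (r : ℕ) ∧ (r : ℕ) < off + m then u ⟨r - off, by omega⟩ else 0 := rfl

theorem readBlock_writeBlock_self {n off m : ℕ} (h : off + m ≤ n) (u : Fin m → ℝ) :
    readBlock n off m (writeBlock n off m u) = u := by
  ext r
  have hr : off + (r : ℕ) < n := by omega
  simp [readBlock_apply, writeBlock_apply, hr]

theorem readBlock_writeBlock_disjoint {n off m off' m' : ℕ} (h : off + m ≤ off' ∨ off' + m' ≤ off)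
    (u : Fin m' → ℝ) : readBlock n off m (writeBlock n off' m' u) = 0 := by
  ext r
  rw [readBlock_apply]
  split_ifs with h1
  · rw [writeBlock_apply, dif_neg (by simp only; omega), Pi.zero_apply]
  · rfl

theorem writeBlock_append {n off m m' : ℕ} (a : Fin m → ℝ) (b : Fin m' → ℝ) :
    writeBlock n off (m + m') (Fin.append a b) =
      writeBlock n off m a + writeBlock n (off + m) m' b := by
  ext r
  simp only [Pi.add_apply, writeBlock_apply]
  by_cases h1 : (r : ℕ) < off
  · rw [dif_neg (by omega), dif_neg (by omega), dif_neg (by omega), add_zero]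
  by_cases h2 : (r : ℕ) < off + m
  · rw [dif_pos (by omega), dif_pos (by omega), dif_neg (by omega), add_zero]
    exact Fin.append_left a b ⟨r - off, by omega⟩
  by_cases h3 : (r : ℕ) < off + m + m'
  · rw [dif_pos (by omega), dif_neg (by omega), dif_pos (by omega), zero_add]
    have := Fin.append_right a b ⟨r - (off + m), by omega⟩
    rw [← this]
    congr 1
    ext
    simp
    omega
  · rw [dif_neg (by omega), dif_neg (by omega), dif_neg (by omega), add_zero]

/-- The positional encoding `[1; i; i²; i³]`. -/
noncomputable def posPow (i : ℕ) : Fin 4 → ℝ := fun a => (i : ℝ) ^ (a : ℕ)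

/-- The vector in `ℝⁿ` with the positional encoding as its last four entries. -/
noncomputable def posBlock (n i : ℕ) : Fin n → ℝ := writeBlock n (n - 4) 4 (posPow i)

theorem mkToken_eq {n m : ℕ} (h : m + 4 ≤ n) (i : ℕ) (u : Fin m → ℝ) :
    mkToken n i u = writeBlock n 0 m u + posBlock n i := by
  ext r
  simp only [mkToken, posBlock, Pi.add_apply, writeBlock_apply]
  by_cases h1 : (r : ℕ) < m
  · rw [dif_pos h1, dif_pos (by omega), dif_neg (by omega), add_zero]
    rfl
  · rw [dif_neg h1, dif_neg (by omega : ¬ (0 ≤ (r : ℕ) ∧ (r : ℕ) < 0 + m)), zero_add]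
    by_cases h2 : n ≤ (r : ℕ) + 4
    · rw [if_pos h2, dif_pos (by omega)]
      simp only [posPow]
      congr 1
      omega
    · rw [if_neg h2, dif_neg (by omega)]

theorem readBlock_posBlock_eq_zero {n off m : ℕ} (h : off + m + 4 ≤ n) (i : ℕ) :
    readBlock n off m (posBlock n i) = 0 :=
  readBlock_writeBlock_disjoint (by omega) _

theorem readBlock_posBlock {n : ℕ} (h : 4 ≤ n) (i : ℕ) :
    readBlock n (n - 4) 4 (posBlock n i) = posPow i :=
  readBlock_writeBlock_self (by omega) _

/-! ### Attention heads and MLP layers given by linear maps -/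

theorem relu_sub_relu_neg (t : ℝ) : relu t - relu (-t) = t := by
  unfold relu
  rcases le_total t 0 with h | h
  · rw [max_eq_right h, max_eq_left (by linarith)]; ring
  · rw [max_eq_left h, max_eq_right (by linarith)]; ring

theorem relu_of_nonpos {t : ℝ} (h : t ≤ 0) : relu t = 0 := max_eq_right h

theorem relu_of_nonneg {t : ℝ} (h : 0 ≤ t) : relu t = t := max_eq_left h

theorem leakyReLU_eq {m : ℕ} {ρ : ℝ} (h1 : ρ < 1) (v : Fin m → ℝ) :
    leakyReLU ρ v = (fun r => relu (v r)) - ρ • fun r => relu (-v r) := by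
  ext r
  simp only [leakyReLU, relu, Pi.sub_apply, Pi.smul_apply, smul_eq_mul]
  rcases le_total (v r) 0 with h | h
  · rw [max_eq_right h, max_eq_left (by linarith : 0 ≤ -v r), max_eq_right (by nlinarith)]; ring
  · rw [max_eq_left h, max_eq_right (by linarith : -v r ≤ 0), max_eq_left (by nlinarith)]; ring

/-- Attention layers realize arbitrary bilinear scores and linear values: with `Q = 1`, every
bilinear form is `⟨h, K h'⟩` for some `K`, and superfluous heads get the value matrix `0`. -/
theorem exists_heads {n M : ℕ} {ι : Type*} [Fintype ι] (hcard : Fintype.card ι ≤ M)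
    (β : ι → (Fin n → ℝ) →ₗ[ℝ] (Fin n → ℝ) →ₗ[ℝ] ℝ) (V : ι → (Fin n → ℝ) →ₗ[ℝ] (Fin n → ℝ)) :
    ∃ θ : Fin M → AttnHead n, ∀ (N : ℕ) (H : Fin N → Fin n → ℝ) (i : Fin N),
      attn θ H i = H i + ∑ a, (1 / ((i : ℕ) + 1 : ℝ)) •
        ∑ j ∈ Finset.Iic i, relu (β a (H i) (H j)) • V a (H j) := by
  classical
  obtain ⟨e⟩ : Nonempty (ι ↪ Fin M) :=
    Function.Embedding.nonempty_of_card_le (by simpa using hcard)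
  refine ⟨Function.extend e
    (fun a => ⟨1, LinearMap.toMatrix₂' ℝ (β a), LinearMap.toMatrix' (V a)⟩)
    (fun _ => ⟨0, 0, 0⟩), fun N H i => ?_⟩
  unfold attn
  congr 1
  symm
  apply Fintype.sum_of_injective e e.injective
  · intro m hm
    rw [Function.extend_apply' _ _ _ (by simpa using hm)]
    simp
  · intro a
    rw [e.injective.extend_apply]
    congr 1
    refine Finset.sum_congr rfl fun j _ => ?_
    rw [LinearMap.toMatrix'_mulVec, Matrix.one_mulVec, ← Matrix.toLinearMap₂'_apply',
      Matrix.toLinearMap₂'_toMatrix']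

/-- A single MLP layer adds any linear function of the positive and negative parts of a linear
function of the token, which takes two neurons per component. -/
theorem exists_mlp {n : ℕ} {ι : Type*} [Fintype ι] (hcard : 2 * Fintype.card ι ≤ n)
    (A : (Fin n → ℝ) →ₗ[ℝ] (ι → ℝ)) (P Q : (ι → ℝ) →ₗ[ℝ] (Fin n → ℝ)) :
    ∃ W₁ W₂ : Matrix (Fin n) (Fin n) ℝ, ∀ (N : ℕ) (H : Fin N → Fin n → ℝ) (i : Fin N),
      mlpLayer W₁ W₂ H i =
        H i + (P (fun a => relu (A (H i) a)) + Q (fun a => relu (-A (H i) a))) := by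
  classical
  obtain ⟨e⟩ : Nonempty (ι ⊕ ι ↪ Fin n) :=
    Function.Embedding.nonempty_of_card_le (by simp; omega)
  refine ⟨LinearMap.toMatrix' (Function.ExtendByZero.linearMap ℝ e ∘ₗ
      (LinearEquiv.sumArrowLequivProdArrow ι ι ℝ ℝ).symm.toLinearMap ∘ₗ A.prod (-A)),
    LinearMap.toMatrix' (P ∘ₗ LinearMap.funLeft ℝ ℝ (e ∘ Sum.inl) +
      Q ∘ₗ LinearMap.funLeft ℝ ℝ (e ∘ Sum.inr)), fun N H i => ?_⟩
  unfold mlpLayer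
  rw [LinearMap.toMatrix'_mulVec, LinearMap.toMatrix'_mulVec]
  change H i + (P (fun a => relu (Function.extend e (Sum.elim (A (H i)) (-A (H i))) 0
      (e (Sum.inl a)))) + Q (fun a => relu (Function.extend e (Sum.elim (A (H i)) (-A (H i))) 0
      (e (Sum.inr a))))) = _
  simp only [e.injective.extend_apply]
  rfl

/-- An MLP layer adds a leaky ReLU network of one layer in the first block, together with any
linear map of rank at most `m`. -/
theorem exists_mlp_leakyReLU {n D m : ℕ} {ρ : ℝ} (h1 : ρ < 1)
    (hn : 2 * (D + m) ≤ n) (A : (Fin n → ℝ) →ₗ[ℝ] (Fin D → ℝ))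
    (R : (Fin n → ℝ) →ₗ[ℝ] (Fin m → ℝ)) (G : (Fin m → ℝ) →ₗ[ℝ] (Fin n → ℝ)) :
    ∃ W₁ W₂ : Matrix (Fin n) (Fin n) ℝ, ∀ (N : ℕ) (H : Fin N → Fin n → ℝ) (i : Fin N),
      mlpLayer W₁ W₂ H i =
        H i + writeBlock n 0 D (leakyReLU ρ (A (H i))) + G (R (H i)) := by
  obtain ⟨W₁, W₂, h⟩ := exists_mlp (ι := Fin D ⊕ Fin m) (by simpa using hn)
    ((LinearEquiv.sumArrowLequivProdArrow (Fin D) (Fin m) ℝ ℝ).symm.toLinearMap ∘ₗ A.prod R)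
    (writeBlock n 0 D ∘ₗ LinearMap.funLeft ℝ ℝ Sum.inl + G ∘ₗ LinearMap.funLeft ℝ ℝ Sum.inr)
    (-(ρ • writeBlock n 0 D ∘ₗ LinearMap.funLeft ℝ ℝ Sum.inl + G ∘ₗ LinearMap.funLeft ℝ ℝ Sum.inr))
  refine ⟨W₁, W₂, fun N H i => ?_⟩
  have hG : R (H i) = (fun a => relu (R (H i) a)) - fun a => relu (-R (H i) a) := by
    ext a; simp [relu_sub_relu_neg]
  rw [h, leakyReLU_eq h1]
  conv_rhs => rw [hG]
  simp only [map_sub, map_smul]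
  change H i + ((writeBlock n 0 D (fun a => relu (A (H i) a)) + G (fun a => relu (R (H i) a))) +
    -(ρ • writeBlock n 0 D (fun a => relu (-A (H i) a)) + G (fun a => relu (-R (H i) a)))) = _
  abel

/-! ### Selecting a token by its position -/

/-- The bilinear form in the positional blocks of two tokens with value
`(i - b) (1 - (i - s - j)²)` at tokens of positions `i` and `j`. It is positive for `j = i - s`
only. The cubic term is the reason for the entry `i³` of a token. -/
noncomputable def selForm (n : ℕ) (s b : ℝ) : (Fin n → ℝ) →ₗ[ℝ] (Fin n → ℝ) →ₗ[ℝ] ℝ :=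
  LinearMap.mk₂ ℝ (fun u v =>
    let p := readBlock n (n - 4) 4 u
    let q := readBlock n (n - 4) 4 v
    (p 1 - b * p 0) * q 0
      - (p 3 - b * p 2 + s ^ 2 * (p 1 - b * p 0) - 2 * s * (p 2 - b * p 1)) * q 0
      + (2 * (p 2 - b * p 1) - 2 * s * (p 1 - b * p 0)) * q 1 - (p 1 - b * p 0) * q 2)
    (by intros; simp only [map_add, Pi.add_apply]; ring)
    (by intros; simp only [map_smul, Pi.smul_apply, smul_eq_mul]; ring)
    (by intros; simp only [map_add, Pi.add_apply]; ring)
    (by intros; simp only [map_smul, Pi.smul_apply, smul_eq_mul]; ring)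

theorem selForm_apply {n i j : ℕ} (s b : ℝ) {u v : Fin n → ℝ}
    (hu : readBlock n (n - 4) 4 u = posPow i)
    (hv : readBlock n (n - 4) 4 v = posPow j) :
    selForm n s b u v = ((i : ℝ) - b) * (1 - ((i : ℝ) - s - j) ^ 2) := by
  simp only [selForm, LinearMap.mk₂_apply, hu, hv, posPow, Fin.val_zero, Fin.val_one, Fin.val_two,
    show ((3 : Fin 4) : ℕ) = 3 from rfl]
  ring

theorem relu_selForm {n i j s : ℕ} {b : ℝ} (hb : b ≤ i) {u v : Fin n → ℝ}
    (hu : readBlock n (n - 4) 4 u = posPow i)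
    (hv : readBlock n (n - 4) 4 v = posPow j) :
    relu (selForm n s b u v) = if j + s = i then (i : ℝ) - b else 0 := by
  rw [selForm_apply _ _ hu hv]
  split_ifs with h
  · have : (i : ℝ) - s - j = 0 := by rw [← h]; push_cast; ring
    rw [this, relu_of_nonneg (by simpa using hb)]; ring
  · apply relu_of_nonpos
    have h1 : (1 : ℤ) ≤ ((i : ℤ) - s - j) ^ 2 := by
      have : (i : ℤ) - s - j ≠ 0 := by omega
      exact Int.one_le_abs this |>.trans (by rw [← sq_abs]; nlinarith [Int.one_le_abs this])
    have h2 : (1 : ℝ) ≤ ((i : ℝ) - s - j) ^ 2 := by exact_mod_cast h1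
    exact mul_nonpos_of_nonneg_of_nonpos (by linarith) (by linarith)

/-- A head with the score `selForm n s b` copies from the token `s` positions earlier, with weight
`i - b` at position `i`, and adds nothing when there is no such token. -/
theorem sum_relu_selForm {n N : ℕ} (s : ℕ) {b : ℝ} (hb : b ≤ 1) {H : Fin N → Fin n → ℝ}
    (hH : ∀ j, readBlock n (n - 4) 4 (H j) = posPow (j + 1))
    (i : Fin N) {E : Type*} [AddCommGroup E] [Module ℝ E] (f : Fin N → E) :
    ∑ j ∈ Finset.Iic i, relu (selForm n s b (H i) (H j)) • f j =
      if s ≤ (i : ℕ) then ((i : ℝ) + 1 - b) • f ⟨i - s, by omega⟩ else 0 := by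
  have hb' : b ≤ (((i : ℕ) + 1 : ℕ) : ℝ) := by
    push_cast; linarith [Nat.cast_nonneg (α := ℝ) (i : ℕ)]
  simp only [relu_selForm hb' (hH i) (hH _)]
  split_ifs with h
  · rw [Finset.sum_eq_single ⟨i - s, by omega⟩]
    · rw [if_pos (by simp only; omega)]; push_cast; rfl
    · intro j _ hj
      have : ¬ ((j : ℕ) + 1 + s = i + 1) := fun h' => hj (Fin.ext (by simp only; omega))
      rw [if_neg this, zero_smul]
    · intro h'
      exact absurd (Finset.mem_Iic.2 (Fin.le_def.2 (by simp))) h'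
  · refine Finset.sum_eq_zero fun j _ => ?_
    rw [if_neg (by omega), zero_smul]

/-! ### Ridge regression and gradient descent -/

open scoped RealInnerProductSpace in
/-- One step of gradient descent on a ridge objective. If `e` is the difference to the minimizer,
then the step replaces `e` by the mean over the samples of
`e - η (⟪φⱼ, e⟫ φⱼ + lam' e)`, and for a step size below the inverse of the smoothness constant
each of these vectors has norm at most `(1 - η lam') ‖e‖`. -/
theorem norm_gradient_step_le {E ι : Type*} [NormedAddCommGroup E] [InnerProductSpace ℝ E]
    {s : Finset ι} (hs : s.Nonempty) {φ : ι → E} {B η lam' : ℝ}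
    (hη : 0 ≤ η) (hφ : ∀ j ∈ s, ‖φ j‖ ≤ B) (hstep : η * (B ^ 2 + lam') ≤ 1) (e : E) :
    ‖e - η • ((1 / (s.card : ℝ)) • ∑ j ∈ s, ⟪φ j, e⟫ • φ j + lam' • e)‖ ≤ (1 - η * lam') * ‖e‖ := by
  have hc : (0 : ℝ) < s.card := by exact_mod_cast hs.card_pos
  have h1 : e - η • ((1 / (s.card : ℝ)) • ∑ j ∈ s, ⟪φ j, e⟫ • φ j + lam' • e) =
      (1 / (s.card : ℝ)) • ∑ j ∈ s, ((1 - η * lam') • e - (η * ⟪φ j, e⟫) • φ j) := by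
    rw [Finset.sum_sub_distrib, Finset.sum_const, smul_sub, ← Nat.cast_smul_eq_nsmul ℝ, smul_smul,
      one_div, inv_mul_cancel₀ hc.ne', one_smul]
    simp only [mul_smul, ← Finset.smul_sum]
    module
  have hq : 0 ≤ 1 - η * lam' := by nlinarith [mul_nonneg hη (sq_nonneg B)]
  have h2 : ∀ j ∈ s, ‖(1 - η * lam') • e - (η * ⟪φ j, e⟫) • φ j‖ ≤ (1 - η * lam') * ‖e‖ := by
    intro j hj
    refine abs_le_of_sq_le_sq' ?_ (by positivity) |>.2
    rw [norm_sub_sq_real, inner_smul_left, inner_smul_right, norm_smul, norm_smul,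
      real_inner_comm e (φ j), mul_pow, mul_pow]
    simp only [Real.norm_eq_abs, sq_abs, RCLike.conj_to_real]
    rw [real_inner_comm]
    have h3 : ‖φ j‖ ^ 2 ≤ B ^ 2 := by gcongr; exact hφ j hj
    have h4 : η * ‖φ j‖ ^ 2 ≤ 1 - η * lam' := by nlinarith
    have h5 : 0 ≤ η * ⟪φ j, e⟫ ^ 2 := by positivity
    nlinarith [mul_le_mul_of_nonneg_left h4 h5, mul_nonneg hq h5]
  rw [h1, norm_smul, Real.norm_of_nonneg (by positivity), one_div, inv_mul_le_iff₀ hc]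
  refine (norm_sum_le_of_le s h2).trans ?_
  rw [Finset.sum_const, nsmul_eq_mul]

/-- A parabola through the origin that stays nonnegative has slope zero there. -/
theorem eq_zero_of_forall_le {g q : ℝ} (h : ∀ t : ℝ, 0 ≤ t * g + t ^ 2 * q) : g = 0 := by
  by_contra hg
  have h1 := h (-g / (|q| + 1))
  have hq : 0 < |q| + 1 := by positivity
  have h2 : -g / (|q| + 1) * g + (-g / (|q| + 1)) ^ 2 * q =
      g ^ 2 / (|q| + 1) ^ 2 * (q - |q| - 1) := by field_simp; ring
  rw [h2] at h1
  have h3 : 0 < g ^ 2 / (|q| + 1) ^ 2 := by positivity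
  nlinarith [le_abs_self q]

theorem norm_sq_add_single {d : ℕ} (v : Fin d → ℝ) (c : Fin d) (s : ℝ) :
    ‖WithLp.toLp 2 (v + Pi.single c s)‖ ^ 2 = ‖WithLp.toLp 2 v‖ ^ 2 + 2 * s * v c + s ^ 2 := by
  have h : ∀ c', (v c' + (Pi.single c s : Fin d → ℝ) c') ^ 2 =
      v c' ^ 2 + if c = c' then 2 * s * v c + s ^ 2 else 0 := by
    intro c'
    by_cases hc : c = c'
    · subst hc; simp; ring
    · simp [hc]
  simp only [EuclideanSpace.real_norm_sq_eq, Pi.add_apply, h, Finset.sum_add_distrib]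
  simp [add_assoc]

/-- The normal equations of ridge regression, from the variation of a single entry of `W`. At
`i = 1` the factor `1 / (i - 1)` is `0` and the equations say `W = 0`. -/
theorem IsPhiRidge.normal_eq {N d D k : ℕ} {Φ : (Fin (k * d) → ℝ) → Fin D → ℝ} {lam : ℝ}
    {x : Fin N → Fin d → ℝ} {i : ℕ} {W : Matrix (Fin D) (Fin d) ℝ}
    (hW : IsPhiRidge k Φ lam x i W) (r : Fin D) (c : Fin d) :
    1 / ((i : ℝ) - 1) * ∑ j ∈ Finset.Icc 1 (i - 1),
      ((Wᵀ *ᵥ Φ (augInput k x j)) c - dataAt x (j + 1) c) * Φ (augInput k x j) r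
      + lam * W r c = 0 := by
  set a : ℝ := 1 / (2 * ((i : ℝ) - 1)) with ha
  have ha2 : 1 / ((i : ℝ) - 1) = 2 * a := by
    rw [ha, one_div, one_div, mul_inv]; ring
  set g := 1 / ((i : ℝ) - 1) * ∑ j ∈ Finset.Icc 1 (i - 1),
      ((Wᵀ *ᵥ Φ (augInput k x j)) c - dataAt x (j + 1) c) * Φ (augInput k x j) r
      + lam * W r c with hg
  refine eq_zero_of_forall_le
    (q := a * ∑ j ∈ Finset.Icc 1 (i - 1), Φ (augInput k x j) r ^ 2 + lam / 2) fun t => ?_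
  have h := sub_nonneg.2 (hW (W + t • Matrix.single r c 1))
  refine h.trans_eq ?_
  have e1 : ∀ j, ‖WithLp.toLp 2 ((W + t • Matrix.single r c 1)ᵀ *ᵥ Φ (augInput k x j)
      - dataAt x (j + 1))‖ ^ 2 = ‖WithLp.toLp 2 (Wᵀ *ᵥ Φ (augInput k x j) - dataAt x (j + 1))‖ ^ 2
        + 2 * t * (((Wᵀ *ᵥ Φ (augInput k x j)) c - dataAt x (j + 1) c) * Φ (augInput k x j) r)
        + t ^ 2 * Φ (augInput k x j) r ^ 2 := by
    intro j
    have e : (W + t • Matrix.single r c 1)ᵀ *ᵥ Φ (augInput k x j) - dataAt x (j + 1) =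
        Wᵀ *ᵥ Φ (augInput k x j) - dataAt x (j + 1) +
          Pi.single c (t * Φ (augInput k x j) r) := by
      rw [Matrix.transpose_add, Matrix.add_mulVec, Matrix.transpose_smul, Matrix.transpose_single,
        Matrix.smul_mulVec, Matrix.single_mulVec]
      ext c'
      by_cases hc : c' = c
      · subst hc; simp; ring
      · simp [hc]
    rw [e, norm_sq_add_single, Pi.sub_apply]
    ring
  have e2 : ∑ r', ∑ c', (W + t • Matrix.single r c (1 : ℝ)) r' c' ^ 2 =
      ∑ r', ∑ c', W r' c' ^ 2 + 2 * t * W r c + t ^ 2 := by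
    have : ∀ r' c', (W + t • Matrix.single r c (1 : ℝ)) r' c' ^ 2 =
        W r' c' ^ 2 + if r = r' then (if c = c' then 2 * t * W r c + t ^ 2 else 0) else 0 := by
      intro r' c'
      simp only [Matrix.add_apply, Matrix.smul_apply, Matrix.single_apply, smul_eq_mul]
      by_cases h1 : r = r'
      · by_cases h2 : c = c'
        · subst h1 h2; simp; ring
        · simp [h2]
      · simp [h1]
    simp only [this, Finset.sum_add_distrib]
    simp [add_assoc]
  unfold ridgeLoss
  simp only [e1, e2, Finset.sum_add_distrib, ← Finset.mul_sum]
  rw [hg, ha2]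
  ring

/-- One gradient descent step of size `η` for `(i - 1) / i` times the ridge objective at position
`i` (one-based), from the samples `(ψ j, y j)` at the positions `j ≤ i`. The normalization `1 / i`
is the one of the attention layer. -/
noncomputable def gradStep {N d D : ℕ} (η lam : ℝ) (ψ : Fin N → Fin D → ℝ) (y : Fin N → Fin d → ℝ)
    (i : Fin N) (w : Matrix (Fin D) (Fin d) ℝ) : Matrix (Fin D) (Fin d) ℝ :=
  Matrix.of fun r c => w r c - η * (1 / ((i : ℕ) + 1 : ℝ) *
    (∑ j ∈ Finset.Iic i, ((wᵀ *ᵥ ψ j) c - y j c) * ψ j r + (i : ℕ) * lam * w r c))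

/-- The features of the previous position, and `0` at the first position. Position `j` carries the
regression sample `(laggedFeature j, xⱼ)`; the one at the first position has no influence. -/
noncomputable def laggedFeature {N d D : ℕ} (k : ℕ) (Φ : (Fin (k * d) → ℝ) → Fin D → ℝ)
    (x : Fin N → Fin d → ℝ) (j : Fin N) : Fin D → ℝ :=
  if (j : ℕ) = 0 then 0 else Φ (augInput k x j)

theorem dataAt_succ {N d : ℕ} (x : Fin N → Fin d → ℝ) (j : Fin N) : dataAt x (j + 1) = x j := by
  unfold dataAt
  rw [dif_pos ⟨by omega, by omega⟩]
  rfl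

/-- The ridge estimator is a fixed point of the gradient step. -/
theorem IsPhiRidge.grad_eq_zero {N d D k : ℕ} {Φ : (Fin (k * d) → ℝ) → Fin D → ℝ} {lam : ℝ}
    {x : Fin N → Fin d → ℝ} {i : Fin N} {W : Matrix (Fin D) (Fin d) ℝ}
    (hW : IsPhiRidge k Φ lam x (i + 1) W) (r : Fin D) (c : Fin d) :
    ∑ j ∈ Finset.Iic i, ((Wᵀ *ᵥ laggedFeature k Φ x j) c - x j c) * laggedFeature k Φ x j r
      + (i : ℕ) * lam * W r c = 0 := by
  have h := hW.normal_eq r c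
  -- the summands as a function on `ℕ`, to pass from `Fin N` to one-based positions
  set G : ℕ → ℝ := fun j => if j = 0 then 0 else
    ((Wᵀ *ᵥ Φ (augInput k x j)) c - dataAt x (j + 1) c) * Φ (augInput k x j) r with hG
  have e1 : ∑ j ∈ Finset.Iic i,
      ((Wᵀ *ᵥ laggedFeature k Φ x j) c - x j c) * laggedFeature k Φ x j r =
      ∑ j ∈ Finset.Iic i, G (Fin.valEmbedding j) := by
    refine Finset.sum_congr rfl fun j _ => ?_
    simp only [hG, laggedFeature, Fin.valEmbedding_apply, dataAt_succ]
    split_ifs <;> simp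
  have e2 : ∑ j ∈ Finset.Icc 1 (i : ℕ), G j = ∑ j ∈ Finset.Iic (i : ℕ), G j := by
    refine Finset.sum_subset (fun j hj => Finset.mem_Iic.2 (Finset.mem_Icc.1 hj).2)
      fun j hj hj' => if_pos ?_
    simp only [Finset.mem_Iic, Finset.mem_Icc] at hj hj'
    omega
  have e3 : ∑ j ∈ Finset.Icc 1 (i : ℕ), G j = ∑ j ∈ Finset.Icc 1 ((i : ℕ) + 1 - 1),
      ((Wᵀ *ᵥ Φ (augInput k x j)) c - dataAt x (j + 1) c) * Φ (augInput k x j) r :=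
    Finset.sum_congr (by simp) fun j hj => if_neg (by simp at hj; omega)
  rw [← e3] at h
  rw [e1, ← Finset.sum_map, Fin.map_valEmbedding_Iic, ← e2]
  rcases Nat.eq_zero_or_pos (i : ℕ) with h0 | h0
  · simp [h0]
  · have h0' : ((i : ℕ) : ℝ) ≠ 0 := by positivity
    push_cast at h
    rw [add_sub_cancel_right] at h
    field_simp at h
    linarith

/-- At the first position the ridge estimator vanishes. -/
theorem IsPhiRidge.eq_zero_of_first {N d D k : ℕ} {Φ : (Fin (k * d) → ℝ) → Fin D → ℝ} {lam : ℝ}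
    (hlam : 0 < lam) {x : Fin N → Fin d → ℝ} {W : Matrix (Fin D) (Fin d) ℝ}
    (hW : IsPhiRidge k Φ lam x 1 W) : W = 0 := by
  ext r c
  have h := hW.normal_eq r c
  simpa [hlam.ne'] using h

/-- Column `c` of a matrix as a point of Euclidean space. -/
noncomputable def colVec {D d : ℕ} (w : Matrix (Fin D) (Fin d) ℝ) (c : Fin d) :
    EuclideanSpace ℝ (Fin D) := WithLp.toLp 2 fun r => w r c

theorem mulVec_transpose_eq_inner {D d : ℕ} (w : Matrix (Fin D) (Fin d) ℝ) (c : Fin d)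
    (v : Fin D → ℝ) : (wᵀ *ᵥ v) c = inner ℝ (WithLp.toLp 2 v) (colVec w c) := by
  simp [colVec, Matrix.mulVec, dotProduct, PiLp.inner_apply]

/-- One gradient step contracts the error of each column, since the ridge estimator satisfies the
normal equations. -/
theorem norm_colVec_gradStep_sub_le {N d D k : ℕ} {Φ : (Fin (k * d) → ℝ) → Fin D → ℝ}
    {lam BΦ η : ℝ} (hlam : 0 < lam) (hBΦ : 0 ≤ BΦ) (hη : 0 ≤ η) (hstep : η * (BΦ ^ 2 + lam) ≤ 1)
    {x : Fin N → Fin d → ℝ} {i : Fin N} {W : Matrix (Fin D) (Fin d) ℝ}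
    (hW : IsPhiRidge k Φ lam x (i + 1) W)
    (hΦ : ∀ j : Fin N, ‖WithLp.toLp 2 (Φ (augInput k x (j + 1)))‖ ≤ BΦ)
    (w : Matrix (Fin D) (Fin d) ℝ) (c : Fin d) :
    ‖colVec (gradStep η lam (laggedFeature k Φ x) x i w) c - colVec W c‖ ≤
      (1 - η * ((i : ℕ) / ((i : ℕ) + 1 : ℝ) * lam)) * ‖colVec w c - colVec W c‖ := by
  set ψ := laggedFeature k Φ x with hψ
  have hi : (0 : ℝ) < (i : ℕ) + 1 := by positivity
  have hψB : ∀ j ∈ Finset.Iic i, ‖WithLp.toLp 2 (ψ j)‖ ≤ BΦ := by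
    intro j _
    simp only [hψ, laggedFeature]
    split_ifs with h
    · simpa using hBΦ
    · have := hΦ ⟨j - 1, by omega⟩
      simpa only [Nat.sub_add_cancel (Nat.one_le_iff_ne_zero.2 h)] using this
  have hle : (i : ℕ) / ((i : ℕ) + 1 : ℝ) * lam ≤ lam := by
    have : (i : ℕ) / ((i : ℕ) + 1 : ℝ) ≤ 1 := by rw [div_le_one hi]; linarith
    nlinarith
  refine le_trans (le_of_eq ?_) (norm_gradient_step_le (s := Finset.Iic i) ⟨i, by simp⟩ hη hψB
    (le_trans (by gcongr) hstep) (colVec w c - colVec W c))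
  congr 1
  ext r
  have h := hW.grad_eq_zero r c
  rw [← hψ] at h
  simp only [Fin.card_Iic, PiLp.sub_apply, PiLp.smul_apply, PiLp.add_apply, WithLp.ofLp_sum,
    Finset.sum_apply, smul_eq_mul, inner_sub_right, ← mulVec_transpose_eq_inner]
  simp only [colVec, gradStep, Matrix.of_apply]
  have e : ∑ j ∈ Finset.Iic i, ((wᵀ *ᵥ ψ j) c - (Wᵀ *ᵥ ψ j) c) * ψ j r =
      ∑ j ∈ Finset.Iic i, ((wᵀ *ᵥ ψ j) c - x j c) * ψ j r -
      ∑ j ∈ Finset.Iic i, ((Wᵀ *ᵥ ψ j) c - x j c) * ψ j r := by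
    rw [← Finset.sum_sub_distrib]
    exact Finset.sum_congr rfl fun j _ => by ring
  rw [e, eq_neg_of_add_eq_zero_left h]
  push_cast
  field_simp
  ring

/-- Gradient descent from `0` converges to the ridge estimator at the rate `1 - η lam / 2`, at all
positions: the factor `(i - 1) / i` of the objective is at least `1 / 2` from the second position
on, and at the first position there is no error. -/
theorem norm_colVec_iterate_sub_le {N d D k : ℕ} {Φ : (Fin (k * d) → ℝ) → Fin D → ℝ}
    {lam BΦ η : ℝ} (hlam : 0 < lam) (hBΦ : 0 ≤ BΦ) (hη : 0 ≤ η) (hstep : η * (BΦ ^ 2 + lam) ≤ 1)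
    {x : Fin N → Fin d → ℝ} {i : Fin N} {W : Matrix (Fin D) (Fin d) ℝ}
    (hW : IsPhiRidge k Φ lam x (i + 1) W)
    (hΦ : ∀ j : Fin N, ‖WithLp.toLp 2 (Φ (augInput k x (j + 1)))‖ ≤ BΦ)
    (c : Fin d) (t : ℕ) :
    ‖colVec ((gradStep η lam (laggedFeature k Φ x) x i)^[t] 0) c - colVec W c‖ ≤
      (1 - η * lam / 2) ^ t * ‖colVec W c‖ := by
  have hη1 : η * lam ≤ 1 := by nlinarith [mul_nonneg hη (sq_nonneg BΦ)]
  have hq : 0 ≤ 1 - η * lam / 2 := by linarith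
  have h0 : colVec (0 : Matrix (Fin D) (Fin d) ℝ) c = 0 := by ext r; simp [colVec]
  induction t with
  | zero => simp [h0]
  | succ t ih =>
    rw [Function.iterate_succ_apply']
    refine (norm_colVec_gradStep_sub_le hlam hBΦ hη hstep hW hΦ _ c).trans ?_
    have hi : (0 : ℝ) < (i : ℕ) + 1 := by positivity
    rcases Nat.eq_zero_or_pos (i : ℕ) with hi0 | hi0
    · have hW0 : W = 0 := by
        rw [hi0] at hW
        exact hW.eq_zero_of_first hlam
      rw [hW0, h0, norm_zero, mul_zero] at ih ⊢
      rw [le_antisymm ih (norm_nonneg _), mul_zero]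
    · have h1 : 1 / 2 ≤ (i : ℕ) / ((i : ℕ) + 1 : ℝ) := by
        have : (1 : ℝ) ≤ (i : ℕ) := by exact_mod_cast hi0
        rw [div_le_div_iff₀ (by norm_num) hi]; linarith
      have h2 : 1 - η * ((i : ℕ) / ((i : ℕ) + 1 : ℝ) * lam) ≤ 1 - η * lam / 2 := by
        nlinarith [mul_le_mul_of_nonneg_right h1 (mul_nonneg hη hlam.le)]
      calc _ ≤ (1 - η * lam / 2) *
          ‖colVec ((gradStep η lam (laggedFeature k Φ x) x i)^[t] 0) c - colVec W c‖ := by gcongr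
        _ ≤ (1 - η * lam / 2) * ((1 - η * lam / 2) ^ t * ‖colVec W c‖) := by gcongr
        _ = _ := by ring

/-! ### The layers that compute the representation -/

theorem attn_zero {n M N : ℕ} (H : Fin N → Fin n → ℝ) :
    attn (fun _ : Fin M => (⟨0, 0, 0⟩ : AttnHead n)) H = H := by
  ext i r
  simp [attn]

theorem mlpLayer_zero {n N : ℕ} (H : Fin N → Fin n → ℝ) :
    mlpLayer (0 : Matrix (Fin n) (Fin n) ℝ) 0 H = H := by
  ext i r
  simp [mlpLayer]

/-- The linear map that places a vector of `ℝᵈ` in block number `b` of `ℝᵏᵈ`. -/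
def placeBlock {k d : ℕ} (b : Fin k) : (Fin d → ℝ) →ₗ[ℝ] (Fin (k * d) → ℝ) where
  toFun u r := if (finProdFinEquiv.symm r).1 = b then u (finProdFinEquiv.symm r).2 else 0
  map_add' u v := by
    ext r; simp only [Pi.add_apply]; split_ifs <;> simp
  map_smul' a v := by
    ext r; simp only [Pi.smul_apply]; split_ifs <;> simp

theorem augInput_eq_sum {N d : ℕ} (k : ℕ) (x : Fin N → Fin d → ℝ) (i : ℕ) :
    augInput k x i = ∑ b : Fin k, placeBlock b (dataAt x (i + 1 + (b : ℕ) - k)) := by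
  ext r
  rw [Finset.sum_apply, Finset.sum_eq_single (finProdFinEquiv.symm r).1]
  · simp only [placeBlock, LinearMap.coe_mk, AddHom.coe_mk, if_true]
    rfl
  · intro b _ hb
    exact if_neg (Ne.symm hb)
  · intro h
    exact absurd (Finset.mem_univ _) h

/-- Block number `b` of a vector of `ℝᵏᵈ`. -/
def takeBlock {k d : ℕ} (b : Fin k) : (Fin (k * d) → ℝ) →ₗ[ℝ] (Fin d → ℝ) :=
  LinearMap.funLeft ℝ ℝ fun c => finProdFinEquiv (b, c)

theorem takeBlock_augInput {N d k : ℕ} (hk : 1 ≤ k) (x : Fin N → Fin d → ℝ) (i : Fin N) :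
    takeBlock ⟨k - 1, by omega⟩ (augInput k x (i + 1)) = x i := by
  ext c
  simp only [takeBlock, LinearMap.funLeft_apply, augInput, Equiv.symm_apply_apply]
  rw [show (i : ℕ) + 1 + 1 + (k - 1) - k = i + 1 by omega, dataAt_succ]

/-- Head number `b` of the attention layer copies the data vector `k - 1 - b` positions earlier
into block `b`; the head that looks at the token itself also clears the first block. -/
theorem exists_heads_augInput {n M k d : ℕ} (hk : 1 ≤ k) (hd : 1 ≤ d) (hM : k ≤ M)
    (hn : k * d + 4 ≤ n) :
    ∃ θ : Fin M → AttnHead n, ∀ (N : ℕ) (x : Fin N → Fin d → ℝ) (i : Fin N),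
      attn θ (fun i => mkToken n (i + 1) (x i)) i =
        mkToken n (i + 1) (augInput k x (i + 1)) := by
  have hkd : d ≤ k * d := Nat.le_mul_of_pos_left d hk
  set last : Fin k := ⟨k - 1, by omega⟩ with hlast
  obtain ⟨θ, hθ⟩ := exists_heads (n := n) (M := M) (ι := Fin k) (by simpa using hM)
    (fun b => selForm n ((k - 1 - (b : ℕ) : ℕ) : ℝ) 0)
    (fun b => (writeBlock n 0 (k * d) ∘ₗ placeBlock b -
      if b = last then writeBlock n 0 d else 0) ∘ₗ readBlock n 0 d)
  refine ⟨θ, fun N x i => ?_⟩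
  have hread : ∀ j : Fin N, readBlock n 0 d (mkToken n (j + 1) (x j)) = x j := by
    intro j
    rw [mkToken_eq (by omega), map_add, readBlock_writeBlock_self (by omega),
      readBlock_posBlock_eq_zero (by omega), add_zero]
  have hpos : ∀ j : Fin N, readBlock n (n - 4) 4 (mkToken n (j + 1) (x j)) = posPow (j + 1) := by
    intro j
    rw [mkToken_eq (by omega), map_add, readBlock_writeBlock_disjoint (by omega),
      readBlock_posBlock (by omega), zero_add]
  rw [hθ]
  simp only [LinearMap.comp_apply, hread]
  simp only [sum_relu_selForm _ zero_le_one hpos]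
  have hi : ((i : ℕ) : ℝ) + 1 ≠ 0 := by positivity
  -- for the nonpositive positions `i - (k - 1 - b)` the head is inactive, and `dataAt` is `0`
  have hterm : ∀ b : Fin k, (1 / ((i : ℕ) + 1 : ℝ)) •
      (if h : k - 1 - (b : ℕ) ≤ (i : ℕ) then ((i : ℕ) + 1 - 0 : ℝ) •
        (writeBlock n 0 (k * d) ∘ₗ placeBlock b - if b = last then writeBlock n 0 d else 0)
          (x ⟨i - (k - 1 - (b : ℕ)), by omega⟩) else 0) =
      writeBlock n 0 (k * d) (placeBlock b (dataAt x (i + 1 + 1 + (b : ℕ) - k))) -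
        if b = last then writeBlock n 0 d (x i) else 0 := by
    intro b
    by_cases h : k - 1 - (b : ℕ) ≤ (i : ℕ)
    · rw [dif_pos h, smul_smul, sub_zero, one_div, inv_mul_cancel₀ hi, one_smul,
        LinearMap.sub_apply, LinearMap.comp_apply]
      have e : (i : ℕ) + 1 + 1 + b - k = ((⟨i - (k - 1 - (b : ℕ)), by omega⟩ : Fin N) : ℕ) + 1 := by
        simp only; omega
      rw [e, dataAt_succ]
      congr 1
      by_cases hb : b = last
      · subst hb
        rw [if_pos rfl, if_pos rfl]
        congr 3
        simp [hlast]
      · rw [if_neg hb, if_neg hb]; rfl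
    · have hb : b ≠ last := by
        rintro rfl
        exact h (by simp [hlast])
      rw [dif_neg h, if_neg hb, smul_zero, sub_zero]
      have e : (i : ℕ) + 1 + 1 + b - k = 0 := by omega
      have e0 : dataAt x 0 = 0 := dif_neg (by omega)
      rw [e, e0, map_zero, map_zero]
  rw [mkToken_eq (by omega), mkToken_eq (by omega), augInput_eq_sum, map_sum]
  simp only [← dite_eq_ite] at hterm ⊢
  rw [Finset.sum_congr rfl fun b _ => hterm b, Finset.sum_sub_distrib]
  simp only [dite_eq_ite, Finset.sum_ite_eq', Finset.mem_univ, if_true]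
  abel

/-- The first layer. Its MLP reads `xᵢ` off the last block of the augmented input. -/
theorem exists_first_layer {n M k d D : ℕ} (hk : 1 ≤ k) (hd : 1 ≤ d) (hM : k ≤ M)
    (hn : k * d + 4 ≤ n) (hn' : 2 * (D + k * d) ≤ n) (hn'' : D + d + 4 ≤ n) {ρ : ℝ} (hρ : ρ < 1)
    (B₁ : Matrix (Fin D) (Fin (k * d)) ℝ) :
    ∃ θ : TFLayer n M, ∀ (N : ℕ) (x : Fin N → Fin d → ℝ) (i : Fin N),
      attn θ.heads (fun i => mkToken n (i + 1) (x i)) i =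
        mkToken n (i + 1) (augInput k x (i + 1)) ∧
      θ.apply (fun i => mkToken n (i + 1) (x i)) i =
        mkToken n (i + 1) (Fin.append (leakyReLU ρ (B₁ *ᵥ augInput k x (i + 1))) (x i)) := by
  obtain ⟨θ, hθ⟩ := exists_heads_augInput hk hd hM hn
  obtain ⟨W₁, W₂, hW⟩ := exists_mlp_leakyReLU hρ hn' (B₁.mulVecLin ∘ₗ readBlock n 0 (k * d))
    (readBlock n 0 (k * d))
    (writeBlock n D d ∘ₗ takeBlock ⟨k - 1, by omega⟩ - writeBlock n 0 (k * d))
  refine ⟨⟨θ, W₁, W₂⟩, fun N x i => ⟨hθ N x i, ?_⟩⟩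
  unfold TFLayer.apply
  rw [hW]
  simp only [hθ]
  have hread : readBlock n 0 (k * d) (mkToken n (i + 1) (augInput k x (i + 1))) =
      augInput k x (i + 1) := by
    rw [mkToken_eq hn, map_add, readBlock_writeBlock_self (by omega),
      readBlock_posBlock_eq_zero (by omega), add_zero]
  rw [LinearMap.comp_apply, hread, LinearMap.sub_apply, LinearMap.comp_apply,
    takeBlock_augInput hk, mkToken_eq hn, mkToken_eq hn'', writeBlock_append, zero_add,
    Matrix.mulVecLin_apply]
  abel

/-- A layer of the representation: the attention is trivial, and the MLP replaces the features. -/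
theorem exists_hidden_layer {n M d D : ℕ} (hn : 2 * (D + D) ≤ n) (hn' : D + d + 4 ≤ n) {ρ : ℝ}
    (hρ : ρ < 1) (A : Matrix (Fin D) (Fin D) ℝ) :
    ∃ θ : TFLayer n M, ∀ (N : ℕ) (H : Fin N → Fin n → ℝ) (i : Fin N) (p : ℕ) (u : Fin D → ℝ)
      (y : Fin d → ℝ), H i = mkToken n p (Fin.append u y) →
      θ.apply H i = mkToken n p (Fin.append (leakyReLU ρ (A *ᵥ u)) y) := by
  obtain ⟨W₁, W₂, hW⟩ := exists_mlp_leakyReLU hρ hn (A.mulVecLin ∘ₗ readBlock n 0 D)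
    (readBlock n 0 D) (-writeBlock n 0 D)
  refine ⟨⟨fun _ => ⟨0, 0, 0⟩, W₁, W₂⟩, fun N H i p u y h => ?_⟩
  unfold TFLayer.apply
  rw [hW]
  simp only [attn_zero, h]
  have hread : readBlock n 0 D (mkToken n p (Fin.append u y)) = u := by
    rw [mkToken_eq hn', writeBlock_append, map_add, map_add, readBlock_writeBlock_self (by omega),
      readBlock_writeBlock_disjoint (by omega), readBlock_posBlock_eq_zero (by omega), add_zero,
      add_zero]
  rw [LinearMap.comp_apply, hread, mkToken_eq hn', mkToken_eq hn', writeBlock_append,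
    writeBlock_append, LinearMap.neg_apply, Matrix.mulVecLin_apply]
  abel

/-! ### The layout of tokens during gradient descent -/

/-- A matrix as a vector, the rows one after another. -/
def flattenMat {D d : ℕ} : Matrix (Fin D) (Fin d) ℝ →ₗ[ℝ] (Fin (D * d) → ℝ) where
  toFun w p := w (finProdFinEquiv.symm p).1 (finProdFinEquiv.symm p).2
  map_add' _ _ := rfl
  map_smul' _ _ := rfl

/-- The inverse of `flattenMat`. -/
def unflattenMat {D d : ℕ} : (Fin (D * d) → ℝ) →ₗ[ℝ] Matrix (Fin D) (Fin d) ℝ where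
  toFun u := Matrix.of fun r c => u (finProdFinEquiv (r, c))
  map_add' _ _ := rfl
  map_smul' _ _ := rfl

theorem unflattenMat_flattenMat {D d : ℕ} (w : Matrix (Fin D) (Fin d) ℝ) :
    unflattenMat (flattenMat w) = w := by
  ext r c
  change w (finProdFinEquiv.symm (finProdFinEquiv (r, c))).1
    (finProdFinEquiv.symm (finProdFinEquiv (r, c))).2 = w r c
  rw [Equiv.symm_apply_apply]

/-- The linear map that writes the regression weights into a token. -/
def writeWeights (n D d : ℕ) : Matrix (Fin D) (Fin d) ℝ →ₗ[ℝ] (Fin n → ℝ) :=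
  writeBlock n (D + d + D + d) (D * d) ∘ₗ flattenMat

/-- The regression weights stored in a token. -/
def readWeights (n D d : ℕ) : (Fin n → ℝ) →ₗ[ℝ] Matrix (Fin D) (Fin d) ℝ :=
  unflattenMat ∘ₗ readBlock n (D + d + D + d) (D * d)

/-- The token `[a; b; f; y; w; 0; 1; p; p²; p³]` of position `p`: `a` are the features at `p`, `b`
is the slot for the prediction, `(f, y)` is the regression sample that ends at `p`, and `w` are the
current weights. -/
noncomputable def regToken (n : ℕ) {D d : ℕ} (a : Fin D → ℝ) (b : Fin d → ℝ) (f : Fin D → ℝ)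
    (y : Fin d → ℝ) (w : Matrix (Fin D) (Fin d) ℝ) (p : ℕ) : Fin n → ℝ :=
  writeBlock n 0 D a + writeBlock n D d b + writeBlock n (D + d) D f +
    writeBlock n (D + d + D) d y + writeWeights n D d w + posBlock n p

section regToken

variable {n D d : ℕ} (a f : Fin D → ℝ) (b y : Fin d → ℝ)
  (w : Matrix (Fin D) (Fin d) ℝ) (p : ℕ)

theorem mkToken_append_eq_regToken (hn : D + d + D + d + D * d + 4 ≤ n) :
    mkToken n p (Fin.append (Fin.append (Fin.append a b) f) y) = regToken n a b f y 0 p := by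
  rw [mkToken_eq (by omega), writeBlock_append, writeBlock_append, writeBlock_append, regToken]
  simp only [zero_add, map_zero, add_zero]

theorem regToken_add_writeWeights (w' : Matrix (Fin D) (Fin d) ℝ) :
    regToken n a b f y w p + writeWeights n D d w' = regToken n a b f y (w + w') p := by
  simp only [regToken, map_add]
  abel

theorem regToken_add_writeBlock (b' : Fin d → ℝ) :
    regToken n a b f y w p + writeBlock n D d b' = regToken n a (b + b') f y w p := by
  simp only [regToken, map_add]
  abel

theorem readBlock_features_regToken (hn : D + d + D + d + D * d + 4 ≤ n) :
    readBlock n 0 D (regToken n a b f y w p) = a := by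
  simp (disch := omega) only [regToken, writeWeights, LinearMap.comp_apply, map_add,
    readBlock_writeBlock_disjoint, readBlock_writeBlock_self, readBlock_posBlock_eq_zero, add_zero]

theorem readBlock_slot_regToken (hn : D + d + D + d + D * d + 4 ≤ n) :
    readBlock n D d (regToken n a b f y w p) = b := by
  simp (disch := omega) only [regToken, writeWeights, LinearMap.comp_apply, map_add,
    readBlock_writeBlock_disjoint, readBlock_writeBlock_self, readBlock_posBlock_eq_zero, add_zero,
    zero_add]

theorem readBlock_lagged_regToken (hn : D + d + D + d + D * d + 4 ≤ n) :
    readBlock n (D + d) D (regToken n a b f y w p) = f := by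
  simp (disch := omega) only [regToken, writeWeights, LinearMap.comp_apply, map_add,
    readBlock_writeBlock_disjoint, readBlock_writeBlock_self, readBlock_posBlock_eq_zero, add_zero,
    zero_add]

theorem readBlock_target_regToken (hn : D + d + D + d + D * d + 4 ≤ n) :
    readBlock n (D + d + D) d (regToken n a b f y w p) = y := by
  simp (disch := omega) only [regToken, writeWeights, LinearMap.comp_apply, map_add,
    readBlock_writeBlock_disjoint, readBlock_writeBlock_self, readBlock_posBlock_eq_zero, add_zero,
    zero_add]

theorem readWeights_regToken (hn : D + d + D + d + D * d + 4 ≤ n) :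
    readWeights n D d (regToken n a b f y w p) = w := by
  simp (disch := omega) only [regToken, writeWeights, readWeights, LinearMap.comp_apply, map_add,
    readBlock_writeBlock_disjoint, readBlock_writeBlock_self, readBlock_posBlock_eq_zero, add_zero,
    zero_add, unflattenMat_flattenMat, map_zero]

theorem readBlock_pos_regToken (hn : D + d + D + d + D * d + 4 ≤ n) :
    readBlock n (n - 4) 4 (regToken n a b f y w p) = posPow p := by
  simp (disch := omega) only [regToken, writeWeights, LinearMap.comp_apply, map_add,
    readBlock_writeBlock_disjoint, readBlock_posBlock, zero_add]

end regToken

/-- The layer between the representation and gradient descent: one head fetches the features of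
the previous token, another one moves the data vector out of the slot for the prediction. -/
theorem exists_shift_layer {n M d D : ℕ} (hM : 2 ≤ M) (hn : D + d + D + d + D * d + 4 ≤ n) :
    ∃ θ : TFLayer n M, ∀ (N : ℕ) (a : Fin N → Fin D → ℝ) (y : Fin N → Fin d → ℝ) (i : Fin N),
      θ.apply (fun i => mkToken n (i + 1) (Fin.append (a i) (y i))) i =
        regToken n (a i) 0 (if h : 1 ≤ (i : ℕ) then a ⟨i - 1, by omega⟩ else 0) (y i) 0
          (i + 1) := by
  obtain ⟨θ, hθ⟩ := exists_heads (n := n) (M := M) (ι := Fin 2) (by simpa using hM)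
    (fun s => selForm n ((s : ℕ) : ℝ) 0)
    ![(writeBlock n (D + d + D) d - writeBlock n D d) ∘ₗ readBlock n D d,
      writeBlock n (D + d) D ∘ₗ readBlock n 0 D]
  refine ⟨⟨θ, 0, 0⟩, fun N a y i => ?_⟩
  have htok : ∀ j : Fin N, mkToken n (j + 1) (Fin.append (a j) (y j)) =
      regToken n (a j) (y j) 0 0 0 (j + 1) := by
    intro j
    rw [mkToken_eq (by omega), writeBlock_append, regToken]
    simp only [zero_add, map_zero, add_zero]
  have hpos : ∀ j : Fin N, readBlock n (n - 4) 4 (regToken n (a j) (y j) 0 0 0 (j + 1)) =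
      posPow (j + 1) := fun j => readBlock_pos_regToken (hn := hn) ..
  have hi : ((i : ℕ) : ℝ) + 1 ≠ 0 := by positivity
  simp only [TFLayer.apply, mlpLayer_zero, hθ, htok]
  rw [Fin.sum_univ_two]
  simp only [sum_relu_selForm _ zero_le_one hpos, Matrix.cons_val_zero, Matrix.cons_val_one,
    LinearMap.comp_apply, readBlock_slot_regToken (hn := hn),
    readBlock_features_regToken (hn := hn)]
  simp only [Fin.val_zero, Fin.val_one, Nat.zero_le, if_true, sub_zero, tsub_zero]
  rw [smul_smul, one_div, inv_mul_cancel₀ hi, one_smul]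
  by_cases h : 1 ≤ (i : ℕ)
  · simp only [h, dif_pos, if_true]
    rw [smul_smul, inv_mul_cancel₀ hi, one_smul]
    simp only [regToken, map_zero, LinearMap.sub_apply]
    abel
  · simp only [h, dif_neg, if_false, not_false_eq_true, smul_zero]
    simp only [regToken, map_zero, LinearMap.sub_apply]
    abel

/-! ### The layers that compute the prediction -/

/-- The matrix with column `c` equal to `v` and all other columns `0`. -/
def columnMat {D d : ℕ} (c : Fin d) : (Fin D → ℝ) →ₗ[ℝ] Matrix (Fin D) (Fin d) ℝ where
  toFun v := Matrix.of fun r c' => if c' = c then v r else 0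
  map_add' u v := by
    ext r c'; simp only [Matrix.of_apply, Matrix.add_apply, Pi.add_apply]; split_ifs <;> simp
  map_smul' a v := by
    ext r c'; simp only [Matrix.of_apply, Matrix.smul_apply, Pi.smul_apply]; split_ifs <;> simp

theorem columnMat_apply {D d : ℕ} (c : Fin d) (v : Fin D → ℝ) (r : Fin D) (c' : Fin d) :
    columnMat c v r c' = if c' = c then v r else 0 := rfl

/-- The bilinear form with value `(wᵀ g)_c`, where `w` are the weights of the first token and `g` is
the block of length `D` at `off` in the second one. -/
noncomputable def predForm (n D d off : ℕ) (c : Fin d) :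
    (Fin n → ℝ) →ₗ[ℝ] (Fin n → ℝ) →ₗ[ℝ] ℝ :=
  LinearMap.mk₂ ℝ (fun u v => ((readWeights n D d u)ᵀ *ᵥ readBlock n off D v) c)
    (by intros; simp [Matrix.add_mulVec])
    (by intros; simp [Matrix.smul_mulVec])
    (by intros; simp [Matrix.mulVec_add])
    (by intros; simp [Matrix.mulVec_smul])

/-- The bilinear form with value `(wᵀ f)_c - y_c`, where `w` are the weights of the first token and
`(f, y)` is the regression sample of the second one. -/
noncomputable def residualForm (n D d : ℕ) (c : Fin d) :
    (Fin n → ℝ) →ₗ[ℝ] (Fin n → ℝ) →ₗ[ℝ] ℝ :=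
  predForm n D d (D + d) c -
  LinearMap.mk₂ ℝ (fun u v => readBlock n (n - 4) 4 u 0 * readBlock n (D + d + D) d v c)
    (by intros; simp only [map_add, Pi.add_apply]; ring)
    (by intros; simp only [map_smul, Pi.smul_apply, smul_eq_mul]; ring)
    (by intros; simp only [map_add, Pi.add_apply]; ring)
    (by intros; simp only [map_smul, Pi.smul_apply, smul_eq_mul]; ring)

/-- The bilinear form in the positional blocks with value `(i - j)²`. -/
noncomputable def distForm (n : ℕ) : (Fin n → ℝ) →ₗ[ℝ] (Fin n → ℝ) →ₗ[ℝ] ℝ :=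
  LinearMap.mk₂ ℝ (fun u v =>
    let p := readBlock n (n - 4) 4 u
    let q := readBlock n (n - 4) 4 v
    p 2 * q 0 - 2 * p 1 * q 1 + p 0 * q 2)
    (by intros; simp only [map_add, Pi.add_apply]; ring)
    (by intros; simp only [map_smul, Pi.smul_apply, smul_eq_mul]; ring)
    (by intros; simp only [map_add, Pi.add_apply]; ring)
    (by intros; simp only [map_smul, Pi.smul_apply, smul_eq_mul]; ring)

theorem distForm_apply {n i j : ℕ} {u v : Fin n → ℝ} (hu : readBlock n (n - 4) 4 u = posPow i)
    (hv : readBlock n (n - 4) 4 v = posPow j) : distForm n u v = ((i : ℝ) - j) ^ 2 := by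
  simp only [distForm, LinearMap.mk₂_apply, hu, hv, posPow, Fin.val_zero, Fin.val_one, Fin.val_two]
  ring

/-- One attention layer performs a gradient step. For each output `c`, two heads with the scores
`±((wᵀ ψⱼ)_c - y_{j,c})` provide the two parts of the residual; one further head, with weight
`i - 1` on the token itself, provides the regularization. -/
theorem exists_gradient_layer {n M d D : ℕ} (hM : 2 * d + 1 ≤ M)
    (hn : D + d + D + d + D * d + 4 ≤ n) (η lam : ℝ) :
    ∃ θ : TFLayer n M, ∀ (N : ℕ) (a ψ : Fin N → Fin D → ℝ) (y : Fin N → Fin d → ℝ)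
      (w : Fin N → Matrix (Fin D) (Fin d) ℝ),
      θ.apply (fun i => regToken n (a i) 0 (ψ i) (y i) (w i) (i + 1)) =
        fun i => regToken n (a i) 0 (ψ i) (y i) (gradStep η lam ψ y i (w i)) (i + 1) := by
  let V : Fin d → (Fin n → ℝ) →ₗ[ℝ] Matrix (Fin D) (Fin d) ℝ := fun c =>
    columnMat c ∘ₗ readBlock n (D + d) D
  obtain ⟨θ, hθ⟩ := exists_heads (n := n) (M := M) (ι := Option (Fin d ⊕ Fin d))
    (by simp; omega)
    (fun s => s.elim (selForm n ((0 : ℕ) : ℝ) 1)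
      (Sum.elim (residualForm n D d) fun c => -residualForm n D d c))
    (fun s => writeWeights n D d ∘ₗ s.elim (-(η * lam) • readWeights n D d)
      (Sum.elim (fun c => -η • V c) fun c => η • V c))
  refine ⟨⟨θ, 0, 0⟩, fun N a ψ y w => funext fun i => ?_⟩
  have hi : ((i : ℕ) : ℝ) + 1 ≠ 0 := by positivity
  have hpos : ∀ j : Fin N,
      readBlock n (n - 4) 4 (regToken n (a j) 0 (ψ j) (y j) (w j) (j + 1)) = posPow (j + 1) :=
    fun j => readBlock_pos_regToken (hn := hn) ..
  have hres : ∀ (j : Fin N) (c : Fin d), residualForm n D d c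
      (regToken n (a i) 0 (ψ i) (y i) (w i) (i + 1))
      (regToken n (a j) 0 (ψ j) (y j) (w j) (j + 1)) = ((w i)ᵀ *ᵥ ψ j) c - y j c := by
    intro j c
    simp only [residualForm, predForm, LinearMap.sub_apply, LinearMap.mk₂_apply, hpos,
      readWeights_regToken (hn := hn), readBlock_lagged_regToken (hn := hn),
      readBlock_target_regToken (hn := hn), posPow, Fin.val_zero, pow_zero, one_mul]
  simp only [TFLayer.apply, mlpLayer_zero, hθ, Fintype.sum_option, Fintype.sum_sum_type,
    Option.elim_none, Option.elim_some, Sum.elim_inl, Sum.elim_inr]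
  simp only [sum_relu_selForm 0 le_rfl hpos, LinearMap.neg_apply, hres, LinearMap.comp_apply,
    LinearMap.smul_apply, readWeights_regToken (hn := hn), V,
    readBlock_lagged_regToken (hn := hn), Nat.zero_le, if_true, ← map_smul, ← map_sum, ← map_add,
    regToken_add_writeWeights, tsub_zero]
  congr 1
  ext r c
  simp only [gradStep, Matrix.add_apply, Matrix.smul_apply, Matrix.sum_apply, Matrix.of_apply,
    columnMat_apply, smul_eq_mul, Finset.sum_ite_eq, Finset.mem_univ, if_true, Fin.eta]
  have e : ∑ j ∈ Finset.Iic i, (((w i)ᵀ *ᵥ ψ j) c - y j c) * ψ j r =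
      ∑ j ∈ Finset.Iic i, relu (((w i)ᵀ *ᵥ ψ j) c - y j c) * ψ j r -
      ∑ j ∈ Finset.Iic i, relu (-(((w i)ᵀ *ᵥ ψ j) c - y j c)) * ψ j r := by
    rw [← Finset.sum_sub_distrib]
    refine Finset.sum_congr rfl fun j _ => ?_
    rw [← sub_mul, relu_sub_relu_neg]
  rw [e]
  simp only [Pi.smul_apply, Finset.sum_apply, smul_eq_mul, mul_left_comm _ (-η),
    mul_left_comm _ η, ← Finset.mul_sum]
  ring

/-- The last layer evaluates the prediction. A head with the score `(wᵀ aⱼ)_c - A (i - j)²` is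
active at `j = i` only, and its value `j` compensates for the normalization `1 / i` of the
attention. -/
theorem exists_readout_layer {n M d D : ℕ} (hM : 2 * d ≤ M)
    (hn : D + d + D + d + D * d + 4 ≤ n) (hd : 2 * d ≤ n) (A : ℝ) :
    ∃ θ : TFLayer n M, ∀ (N : ℕ) (a ψ : Fin N → Fin D → ℝ) (y : Fin N → Fin d → ℝ)
      (w : Fin N → Matrix (Fin D) (Fin d) ℝ) (i : Fin N),
      (∀ j c, |((w i)ᵀ *ᵥ a j) c| ≤ A) →
      readBlock n 0 d
          (θ.apply (fun i => regToken n (a i) 0 (ψ i) (y i) (w i) (i + 1)) i) =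
        (w i)ᵀ *ᵥ a i := by
  let V : Fin d → (Fin n → ℝ) →ₗ[ℝ] (Fin d → ℝ) := fun c =>
    LinearMap.single ℝ (fun _ : Fin d => ℝ) c ∘ₗ LinearMap.proj 1 ∘ₗ readBlock n (n - 4) 4
  obtain ⟨θ, hθ⟩ := exists_heads (n := n) (M := M) (ι := Fin d ⊕ Fin d)
    (by simp; omega)
    (Sum.elim (fun c => predForm n D d 0 c - A • distForm n)
      fun c => -predForm n D d 0 c - A • distForm n)
    (fun s => writeBlock n D d ∘ₗ Sum.elim V (fun c => -V c) s)
  obtain ⟨W₁, W₂, hW⟩ := exists_mlp (n := n) (ι := Fin d) (by simpa using hd)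
    (readBlock n D d - readBlock n 0 d) (writeBlock n 0 d) (-writeBlock n 0 d)
  refine ⟨⟨θ, W₁, W₂⟩, fun N a ψ y w i hA => ?_⟩
  have hi : ((i : ℕ) : ℝ) + 1 ≠ 0 := by positivity
  have hpos : ∀ j : Fin N,
      readBlock n (n - 4) 4 (regToken n (a j) 0 (ψ j) (y j) (w j) (j + 1)) = posPow (j + 1) :=
    fun j => readBlock_pos_regToken (hn := hn) ..
  have hdist : ∀ j : Fin N, distForm n (regToken n (a i) 0 (ψ i) (y i) (w i) (i + 1))
      (regToken n (a j) 0 (ψ j) (y j) (w j) (j + 1)) = ((i : ℝ) - j) ^ 2 := by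
    intro j
    rw [distForm_apply (hpos i) (hpos j)]
    push_cast
    ring
  have hpred : ∀ (j : Fin N) (c : Fin d), predForm n D d 0 c
      (regToken n (a i) 0 (ψ i) (y i) (w i) (i + 1))
      (regToken n (a j) 0 (ψ j) (y j) (w j) (j + 1)) = ((w i)ᵀ *ᵥ a j) c := by
    intro j c
    simp only [predForm, LinearMap.mk₂_apply, readWeights_regToken (hn := hn),
      readBlock_features_regToken (hn := hn)]
  -- the penalty `A (i - j)²` switches off all tokens but the one at `i`
  have hsel : ∀ (g : Fin N → ℝ), (∀ j, |g j| ≤ A) → ∀ f : Fin N → Fin n → ℝ,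
      ∑ j ∈ Finset.Iic i, relu (g j - A * ((i : ℝ) - j) ^ 2) • f j = relu (g i) • f i := by
    intro g hg f
    rw [Finset.sum_eq_single i]
    · simp
    · intro j _ hj
      have h1 : (1 : ℤ) ≤ ((i : ℤ) - j) ^ 2 := by
        have : (i : ℤ) - j ≠ 0 := fun h => hj (Fin.ext (by omega))
        exact (one_le_sq_iff_one_le_abs _).2 (Int.one_le_abs this)
      have h2 : (1 : ℝ) ≤ ((i : ℝ) - j) ^ 2 := by exact_mod_cast h1
      rw [relu_of_nonpos, zero_smul]
      nlinarith [abs_le.1 (hg j), abs_nonneg (g j), hg j]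
    · simp
  have hsel₁ := fun c => hsel (fun j => ((w i)ᵀ *ᵥ a j) c) (hA · c)
  have hsel₂ := fun c => hsel (fun j => -((w i)ᵀ *ᵥ a j) c) fun j => (abs_neg _).trans_le (hA j c)
  have hattn : attn θ (fun i => regToken n (a i) 0 (ψ i) (y i) (w i) (i + 1)) i =
      regToken n (a i) ((w i)ᵀ *ᵥ a i) (ψ i) (y i) (w i) (i + 1) := by
    simp only [hθ, Fintype.sum_sum_type, Sum.elim_inl, Sum.elim_inr]
    simp only [LinearMap.sub_apply, LinearMap.neg_apply, LinearMap.smul_apply, smul_eq_mul, hdist,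
      hpred, LinearMap.comp_apply, hpos, V, hsel₁, hsel₂]
    simp only [← map_smul, ← map_neg, ← map_sum, ← map_add, regToken_add_writeBlock]
    congr 1
    ext c
    have e : ((posPow ((i : ℕ) + 1)) 1) = (i : ℝ) + 1 := by simp [posPow]
    simp only [LinearMap.proj_apply, LinearMap.single_apply, e, Pi.add_apply, Finset.sum_apply,
      Pi.smul_apply, Pi.neg_apply, Pi.single_apply, Pi.zero_apply, smul_eq_mul,
      Finset.sum_ite_eq, Finset.mem_univ, if_true, mul_neg, zero_add]
    conv_rhs => rw [← relu_sub_relu_neg (((w i)ᵀ *ᵥ a i) c)]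
    field_simp
    ring
  have hn0 : 0 + d ≤ n := by omega
  unfold TFLayer.apply
  rw [hW, hattn, LinearMap.neg_apply, ← sub_eq_add_neg, ← map_sub, map_add,
    readBlock_writeBlock_self hn0]
  ext c
  simp only [Pi.add_apply, Pi.sub_apply, relu_sub_relu_neg, LinearMap.sub_apply,
    readBlock_slot_regToken (hn := hn)]
  ring

/-! ### Composition of the layers -/

theorem tfApply_append {n M N : ℕ} (l₁ l₂ : List (TFLayer n M)) (H : Fin N → Fin n → ℝ) :
    tfApply (l₁ ++ l₂) H = tfApply l₂ (tfApply l₁ H) :=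
  List.foldl_append

theorem tfApply_gradient {n M N D d : ℕ} {η lam : ℝ} {θ : TFLayer n M}
    {a ψ : Fin N → Fin D → ℝ} {y : Fin N → Fin d → ℝ}
    (hθ : ∀ w : Fin N → Matrix (Fin D) (Fin d) ℝ,
      θ.apply (fun i : Fin N => regToken n (a i) 0 (ψ i) (y i) (w i) (i + 1)) =
        fun i : Fin N => regToken n (a i) 0 (ψ i) (y i) (gradStep η lam ψ y i (w i)) (i + 1))
    (T : ℕ) (w : Fin N → Matrix (Fin D) (Fin d) ℝ) :
    tfApply (List.replicate T θ)
        (fun i : Fin N => regToken n (a i) 0 (ψ i) (y i) (w i) (i + 1)) =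
      fun i : Fin N =>
        regToken n (a i) 0 (ψ i) (y i) ((gradStep η lam ψ y i)^[T] (w i)) (i + 1) := by
  induction T generalizing w with
  | zero => rfl
  | succ T ih =>
    simp only [Function.iterate_succ_apply]
    rw [← ih fun i => gradStep η lam ψ y i (w i), ← hθ, List.replicate_succ]
    rfl

theorem tfApply_hidden {n M N D d : ℕ} {ρ : ℝ} {hid : Matrix (Fin D) (Fin D) ℝ → TFLayer n M}
    (hhid : ∀ A (N : ℕ) (H : Fin N → Fin n → ℝ) (i : Fin N) (p : ℕ) (u : Fin D → ℝ)
      (y : Fin d → ℝ), H i = mkToken n p (Fin.append u y) →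
      (hid A).apply H i = mkToken n p (Fin.append (leakyReLU ρ (A *ᵥ u)) y))
    (l : List (Matrix (Fin D) (Fin D) ℝ)) (u : Fin N → Fin D → ℝ) (y : Fin N → Fin d → ℝ) :
    tfApply (l.map hid) (fun i : Fin N => mkToken n (i + 1) (Fin.append (u i) (y i))) =
      fun i : Fin N => mkToken n (i + 1)
        (Fin.append (l.foldl (fun u A => leakyReLU ρ (A *ᵥ u)) (u i)) (y i)) := by
  induction l generalizing u with
  | nil => rfl
  | cons A l ih =>
    simp only [List.foldl_cons]
    rw [← ih fun i => leakyReLU ρ (A *ᵥ u i)]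
    rw [List.map_cons, tfApply, List.foldl_cons, tfApply]
    congr 1
    exact funext fun i => hhid A N _ i _ _ _ rfl

/-! ### Lower bounds for the hidden dimension -/

theorem two_mul_add_le_hidDim (k d D : ℕ) : 2 * (D + k * d) ≤ hidDim k d D := by
  have h : 2 * (k + 1) * d ≤ max (2 * (k + 1)) D * d := Nat.mul_le_mul_right _ (le_max_left _ _)
  have e : 2 * (k + 1) * d = 2 * (k * d) + 2 * d := by ring
  unfold hidDim
  omega

theorem mul_add_four_le_hidDim (k d D : ℕ) : k * d + 4 ≤ hidDim k d D := by
  have h : 2 * (k + 1) * d ≤ max (2 * (k + 1)) D * d := Nat.mul_le_mul_right _ (le_max_left _ _)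
  have e : 2 * (k + 1) * d = 2 * (k * d) + 2 * d := by ring
  unfold hidDim
  omega

theorem regToken_le_hidDim (k d D : ℕ) :
    D + d + D + d + D * d + 4 ≤ hidDim k d D := by
  have h : D * d ≤ max (2 * (k + 1)) D * d := Nat.mul_le_mul_right _ (le_max_right _ _)
  unfold hidDim
  omega

theorem four_mul_le_hidDim (k D : ℕ) {d : ℕ} (hd : 1 ≤ d) : 2 * (D + D) ≤ hidDim k d D := by
  have h : D * d ≤ max (2 * (k + 1)) D * d := Nat.mul_le_mul_right _ (le_max_right _ _)
  have h' : D ≤ D * d := Nat.le_mul_of_pos_right _ hd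
  unfold hidDim
  omega

/-! ### The number of gradient steps -/

theorem abs_mulVec_transpose_le {D d : ℕ} (w : Matrix (Fin D) (Fin d) ℝ) (c : Fin d)
    (v : Fin D → ℝ) : |(wᵀ *ᵥ v) c| ≤ ‖WithLp.toLp 2 v‖ * ‖colVec w c‖ := by
  rw [mulVec_transpose_eq_inner]
  exact abs_real_inner_le_norm _ _

theorem colVec_sub {D d : ℕ} (w w' : Matrix (Fin D) (Fin d) ℝ) (c : Fin d) :
    colVec (w - w') c = colVec w c - colVec w' c := rfl

/-- With condition number `κ`, about `2 κ log R` gradient steps reduce the error by a factor `R`. -/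
theorem one_sub_pow_le_inv {κ R : ℝ} (hκ : 1 ≤ κ) (hR : 0 < R) {T : ℕ}
    (hT : 2 * κ * Real.log R ≤ T) : (1 - 1 / (2 * κ)) ^ T ≤ R⁻¹ := by
  have hκ' : 0 < 2 * κ := by linarith
  have h1 : 0 ≤ 1 - 1 / (2 * κ) := by
    rw [sub_nonneg, div_le_one hκ']; linarith
  have h2 : 1 - 1 / (2 * κ) ≤ Real.exp (-(1 / (2 * κ))) := by
    have := Real.add_one_le_exp (-(1 / (2 * κ)))
    linarith
  calc (1 - 1 / (2 * κ)) ^ T ≤ Real.exp (-(1 / (2 * κ))) ^ T := by gcongr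
    _ = Real.exp (-(T / (2 * κ))) := by rw [← Real.exp_nat_mul]; congr 1; ring
    _ ≤ Real.exp (-Real.log R) := by
      gcongr
      rw [le_div_iff₀ hκ']
      linarith
    _ = R⁻¹ := by rw [Real.exp_neg, Real.exp_log hR]

theorem mainTheorem2 :
    ∃ C : ℝ, 0 < C ∧
      ∀ (k d D L : ℕ), 1 ≤ k → 1 ≤ d → 1 ≤ D → 1 ≤ L →
      ∀ (ρ : ℝ), 0 < ρ → ρ < 1 →
      ∀ (B₁ : Matrix (Fin D) (Fin (k * d)) ℝ) (B : Fin (L - 1) → Matrix (Fin D) (Fin D) ℝ)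
        (lam BΦ Bw By ε : ℝ),
        0 < lam → 0 < BΦ → 0 < Bw → 0 < By → 0 < ε → ε < BΦ * Bw / 2 →
      -- the first layer `θ₁` and the list `θs` of the other layers
      ∃ (θ₁ : TFLayer (hidDim k d D) (max (max (3 * d) 5) k))
        (θs : List (TFLayer (hidDim k d D) (max (max (3 * d) 5) k))),
        L + 2 ≤ (θ₁ :: θs).length ∧
        ((θ₁ :: θs).length : ℝ) ≤
          (L : ℝ) + 2 + C * ((1 + BΦ ^ 2 / lam) * Real.log (BΦ * Bw / ε)) ∧
        ∀ (N : ℕ) (x : Fin N → Fin d → ℝ) (W : Fin N → Matrix (Fin D) (Fin d) ℝ),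
          (∀ i : Fin N, IsPhiRidge k (mlpRep ρ B₁ B) lam x (i + 1) (W i)) →
          (∀ i : Fin N, ‖WithLp.toLp 2 (mlpRep ρ B₁ B (augInput k x (i + 1)))‖ ≤ BΦ) →
          (∀ (i : Fin N) (c : Fin d), |x i c| ≤ By) →
          (∀ (i : Fin N) (c : Fin d), ‖WithLp.toLp 2 (fun r => W i r c)‖ ≤ Bw / 2) →
          -- the input tokens `[xᵢ; 0; 1; i; i²; i³]`
          let H : Fin N → Fin (hidDim k d D) → ℝ := fun i => mkToken (hidDim k d D) (i + 1) (x i)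
          -- the first attention layer and the first layer
          (∀ i : Fin N, attn θ₁.heads H i =
            mkToken (hidDim k d D) (i + 1) (augInput k x (i + 1))) ∧
          (∀ i : Fin N, θ₁.apply H i =
            mkToken (hidDim k d D) (i + 1)
              (Fin.append (leakyReLU ρ (B₁ *ᵥ augInput k x (i + 1))) (x i))) ∧
          -- the first `L + 1` layers
          (∀ i : Fin N, tfApply ((θ₁ :: θs).take (L + 1)) H i =
            mkToken (hidDim k d D) (i + 1)
              (Fin.append
                (Fin.append
                  (Fin.append (mlpRep ρ B₁ B (augInput k x (i + 1))) (0 : Fin d → ℝ))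
                  (if (i : ℕ) = 0 then 0 else mlpRep ρ B₁ B (augInput k x i)))
                (x i))) ∧
          -- the prediction in the first `d` entries of the output token
          (∀ (i : Fin N) (c : Fin d),
            |tfApply (θ₁ :: θs) H i (Fin.castLE (le_hidDim k d D) c)
              - ((W i)ᵀ *ᵥ mlpRep ρ B₁ B (augInput k x (i + 1))) c| ≤ ε) := by
  refine ⟨4, by norm_num, ?_⟩
  intro k d D L hk hd _ hL ρ _ hρ B₁ B lam BΦ Bw By ε hlam hBΦ hBw _ hε hεlt
  set n := hidDim k d D with hn
  set M := max (max (3 * d) 5) k with hM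
  have hdim := regToken_le_hidDim k d D
  have hdim' := two_mul_add_le_hidDim k d D
  have hkd : d ≤ k * d := Nat.le_mul_of_pos_left d hk
  have hkdn := mul_add_four_le_hidDim k d D
  set κ : ℝ := 1 + BΦ ^ 2 / lam with hκ
  have hκ1 : 1 ≤ κ := by rw [hκ]; linarith [show 0 ≤ BΦ ^ 2 / lam by positivity]
  set R : ℝ := BΦ * Bw / ε with hR
  have hR2 : 2 < R := by rw [hR, lt_div_iff₀ hε]; linarith
  have hlog : 1 / 2 < Real.log R := by
    have := Real.log_lt_log (by norm_num) hR2
    linarith [Real.log_two_gt_d9]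
  set T : ℕ := ⌈2 * κ * Real.log R⌉₊ with hT
  -- the step size is the inverse of the smoothness constant of the ridge objective
  set η : ℝ := 1 / (BΦ ^ 2 + lam) with hη
  have hη0 : 0 ≤ η := by positivity
  have hstep : η * (BΦ ^ 2 + lam) ≤ 1 := by
    rw [hη, one_div, inv_mul_cancel₀ (by positivity)]
  have hrate : 1 - η * lam / 2 = 1 - 1 / (2 * κ) := by
    rw [hη, hκ]; field_simp; ring
  obtain ⟨θ₁, hθ₁⟩ := exists_first_layer (n := n) (M := M) hk hd (by omega) hkdn hdim' (by omega)
    hρ B₁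
  choose hid hhid using
    exists_hidden_layer (n := n) (M := M) (d := d) (four_mul_le_hidDim k D hd) (by omega) hρ
  obtain ⟨θsh, hθsh⟩ := exists_shift_layer (n := n) (M := M) (d := d) (D := D) (by omega) hdim
  obtain ⟨θgd, hθgd⟩ := exists_gradient_layer (n := n) (M := M) (d := d) (D := D) (by omega) hdim
    η lam
  obtain ⟨θro, hθro⟩ := exists_readout_layer (n := n) (M := M) (d := d) (D := D) (by omega) hdim
    (by omega) (BΦ * Bw)
  set l := (List.ofFn B).map hid with hl
  have hlen : l.length = L - 1 := by simp [hl]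
  refine ⟨θ₁, (l ++ [θsh]) ++ (List.replicate T θgd ++ [θro]), ?_, ?_, ?_⟩
  · simp [hlen]; omega
  · have e : (θ₁ :: ((l ++ [θsh]) ++ (List.replicate T θgd ++ [θro]))).length = L + 2 + T := by
      simp [hlen]; omega
    have hT' : (T : ℝ) < 2 * κ * Real.log R + 1 :=
      Nat.ceil_lt_add_one (by positivity)
    have : 1 / 2 ≤ κ * Real.log R := by nlinarith
    rw [e]
    push_cast
    linarith
  intro N x W hW hΦ _ hWB
  dsimp only
  have h1 : θ₁.apply (fun i : Fin N => mkToken n (i + 1) (x i)) =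
      fun i : Fin N => mkToken n (i + 1)
        (Fin.append (leakyReLU ρ (B₁ *ᵥ augInput k x (i + 1))) (x i)) :=
    funext fun i => (hθ₁ N x i).2
  have h2 : tfApply (θ₁ :: (l ++ [θsh])) (fun i : Fin N => mkToken n (i + 1) (x i)) =
      fun i : Fin N => regToken n (mlpRep ρ B₁ B (augInput k x (i + 1))) 0
        (laggedFeature k (mlpRep ρ B₁ B) x i) (x i) 0 (i + 1) := by
    rw [← List.cons_append, tfApply_append]
    change θsh.apply (tfApply l (θ₁.apply _)) = _
    rw [h1, hl, tfApply_hidden hhid]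
    funext i
    refine (hθsh N (fun i => mlpRep ρ B₁ B (augInput k x (i + 1))) x i).trans ?_
    congr 1
    unfold laggedFeature
    by_cases h : (i : ℕ) = 0
    · rw [dif_neg (by omega), if_pos h]
    · rw [dif_pos (by omega), if_neg h]
      simp only [Nat.sub_add_cancel (Nat.one_le_iff_ne_zero.2 h)]
  refine ⟨fun i => (hθ₁ N x i).1, fun i => (hθ₁ N x i).2, fun i => ?_, fun i c => ?_⟩
  · rw [← List.cons_append, List.take_left' (by simp [hlen]; omega), h2,
      mkToken_append_eq_regToken (hn := hdim)]
    rfl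
  · set w : Fin N → Matrix (Fin D) (Fin d) ℝ :=
      fun i => (gradStep η lam (laggedFeature k (mlpRep ρ B₁ B) x) x i)^[T] 0 with hw
    have herr : ∀ c, ‖colVec (w i) c - colVec (W i) c‖ ≤ R⁻¹ * (Bw / 2) := by
      intro c
      refine (norm_colVec_iterate_sub_le hlam hBΦ.le hη0 hstep (hW i) hΦ c T).trans ?_
      rw [hrate]
      exact mul_le_mul (one_sub_pow_le_inv hκ1 (by linarith) (Nat.le_ceil _)) (hWB i c)
        (norm_nonneg _) (by positivity)
    have hRinv : R⁻¹ ≤ 1 := inv_le_one_of_one_le₀ (by linarith)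
    -- both the estimator and the error are bounded by `Bw / 2`
    have hA : ∀ (j : Fin N) (c : Fin d),
        |((w i)ᵀ *ᵥ mlpRep ρ B₁ B (augInput k x (j + 1))) c| ≤ BΦ * Bw := by
      intro j c
      refine (abs_mulVec_transpose_le _ _ _).trans
        (mul_le_mul (hΦ j) ?_ (norm_nonneg _) hBΦ.le)
      have h4 : ‖colVec (W i) c‖ ≤ Bw / 2 := hWB i c
      have h5 := norm_le_norm_sub_add (colVec (w i) c) (colVec (W i) c)
      nlinarith [herr c]
    have h6 := hθro N (fun i => mlpRep ρ B₁ B (augInput k x (i + 1)))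
      (laggedFeature k (mlpRep ρ B₁ B) x) x w i hA
    have h7 : tfApply (θ₁ :: ((l ++ [θsh]) ++ (List.replicate T θgd ++ [θro])))
        (fun i : Fin N => mkToken n (i + 1) (x i)) i (Fin.castLE (le_hidDim k d D) c) =
        ((w i)ᵀ *ᵥ mlpRep ρ B₁ B (augInput k x (i + 1))) c := by
      rw [← h6, ← List.cons_append, tfApply_append, h2, tfApply_append,
        tfApply_gradient (fun w => hθgd N _ _ x w) T fun _ => 0]
      rw [readBlock_apply, dif_pos (by have := le_hidDim k d D; omega)]
      simp only [zero_add]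
      rfl
    rw [h7, ← Pi.sub_apply, ← Matrix.sub_mulVec, ← Matrix.transpose_sub]
    refine (abs_mulVec_transpose_le _ _ _).trans ?_
    rw [colVec_sub]
    calc _ ≤ BΦ * (R⁻¹ * (Bw / 2)) :=
          mul_le_mul (hΦ i) (herr c) (norm_nonneg _) hBΦ.le
      _ = ε / 2 := by rw [hR]; field_simp
      _ ≤ ε := by linarith
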